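/- Let $G$ be a countable group, let $I,\Lambda$ be non-empty countable sets (countable includes finite), and let $P=(p_{\lambda,i})$ be a $\Lambda\times I$ matrix over $G$ which is normalised, i.e. there are $1_I\in I$ and $1_\Lambda\in\Lambda$ such that $p_{\lambda,1_I}=\epsilon=p_{1_\Lambda,i}$ for all $\lambda\in\Lambda$, $i\in I$, where $\epsilon$ is the identity of $G$. Let $S=\mathcal{M}[G;I,\Lambda;P]$ be the Rees matrix semigroup, that is, the set $I\times G\times\Lambda$ with multiplication $(i,g,\lambda)(j,h,\mu)=(i,g\,p_{\lambda,j}\,h,\mu)$; it is completely simple (it has no proper ideals and contains a primitive idempotent). Every element $a$ of a completely simple semigroup has a unique relative inverse, namely its inverse in the maximal subgroup containing $a$; for a subset $X$, let $\langle X\rangle$ denote the smallest subsemigroup containing $X$ and closed under relative inverses, and call a completely simple subsemigroup finitely generated if it equals $\langle X\rangle$ for some finite $X$. A completely simple semigroup is called homogeneous if every isomorphism between finitely generated completely simple subsemigroups of it extends to an automorphism of it; a group is called homogeneous if every isomorphism between finitely generated subgroups of it extends to an automorphism of it. Let $E(S)$ be the set of idempotents of $S$ and let $G^P=\{p_{\lambda,i}:\lambda\in\Lambda,\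 i\in I\}$. Then $S$ is homogeneous if and only if all of the following hold: $G$ is homogeneous; $\langle E(S)\rangle$ is homogeneous; and the set $G^P$ is a characteristic subgroup of $G$ (a subgroup mapped onto itself by every automorphism of $G$). -/

import Mathlib

/-- The entry set `X^Q` of a `Λ × I` matrix `Q` over `X`. -/
def matrixEntries {X I Λ : Type*} (Q : Matrix Λ I X) : Set X :=
  {x | ∃ (l : Λ) (i : I), Q l i = x}

/-- A sandwich matrix is normalised if some row and some column consist of identity elements.
In particular both index sets are non-empty. -/
def IsNormalised {G I Λ : Type*} [Group G] (P : Matrix Λ I G) : Prop :=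
  ∃ (i₀ : I) (l₀ : Λ), (∀ l : Λ, P l i₀ = 1) ∧ (∀ i : I, P l₀ i = 1)

/-- The set `I × G × Λ` underlying the Rees matrix semigroup `M[G; I, Λ; P]`. -/
@[ext]
structure ReesMatrixSemigroup {G I Λ : Type*} (P : Matrix Λ I G) where
  /-- the coordinate in `I` -/
  row : I
  /-- the coordinate in `G` -/
  val : G
  /-- the coordinate in `Λ` -/
  col : Λ

/-- The multiplication `(i, g, l) (j, h, m) = (i, g * P l j * h, m)`. -/
instance ReesMatrixSemigroup.instSemigroup {G I Λ : Type*} [Group G] (P : Matrix Λ I G) :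
    Semigroup (ReesMatrixSemigroup P) where
  mul x y := ⟨x.row, x.val * P x.col y.row * y.val, y.col⟩
  mul_assoc x y z := by
    change ReesMatrixSemigroup.mk x.row
        ((x.val * P x.col y.row * y.val) * P y.col z.row * z.val) z.col =
      ReesMatrixSemigroup.mk x.row
        (x.val * P x.col y.row * (y.val * P y.col z.row * z.val)) z.col
    simp only [mul_assoc]

/-- A (non-empty, two-sided) ideal of a semigroup. -/
def IsSemigroupIdeal {S : Type*} [Semigroup S] (A : Set S) : Prop :=
  A.Nonempty ∧ ∀ a ∈ A, ∀ s : S, s * a ∈ A ∧ a * s ∈ A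

/-- A primitive idempotent: an idempotent that is minimal among the idempotents in the natural
order `f ≤ e ↔ e * f = f ∧ f * e = f`. -/
def IsPrimitiveIdempotent {S : Type*} [Semigroup S] (e : S) : Prop :=
  IsIdempotentElem e ∧ ∀ f : S, IsIdempotentElem f → e * f = f → f * e = f → f = e

/-- A completely simple semigroup: it has no proper ideals and contains a primitive idempotent. -/
def IsCompletelySimple (S : Type*) [Semigroup S] : Prop :=
  (∀ A : Set S, IsSemigroupIdeal A → A = Set.univ) ∧ ∃ e : S, IsPrimitiveIdempotent e

/-- `b` is the relative inverse of `a`, i.e. the inverse of `a` in the maximal subgroup that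
contains `a`. Such a `b` is unique if it exists, and it exists for every `a` in a completely
simple (more generally, completely regular) semigroup. -/
def IsRelativeInverse {S : Type*} [Semigroup S] (a b : S) : Prop :=
  a * b * a = a ∧ b * a * b = b ∧ a * b = b * a

/-- `⟨X⟩`, the unary subsemigroup generated by `X`: the smallest subsemigroup that contains `X`
and is closed under relative inverses. -/
def unaryClosure {S : Type*} [Semigroup S] (X : Set S) : Subsemigroup S :=
  sInf {T : Subsemigroup S | X ⊆ (T : Set S) ∧
    ∀ a ∈ T, ∀ b : S, IsRelativeInverse a b → b ∈ T}

/-- `⟨E(S)⟩`, generated by the set `E(S)` of all idempotents of `S`. -/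
def idempotentGenerated (S : Type*) [Semigroup S] : Subsemigroup S :=
  unaryClosure {e : S | IsIdempotentElem e}

/-- `T` is a finitely generated completely simple subsemigroup of `S`, where finite generation
is meant for unary semigroups (multiplication and relative inverse). -/
def IsFGCompletelySimpleSub {S : Type*} [Semigroup S] (T : Subsemigroup S) : Prop :=
  IsCompletelySimple T ∧ ∃ X : Set S, X.Finite ∧ T = unaryClosure X

/-- `S` is a homogeneous completely simple semigroup: it is completely simple, and any isomorphism
between finitely generated completely simple subsemigroups extends to an automorphism of `S`. -/
def IsHomogeneousCompletelySimple (S : Type*) [Semigroup S] : Prop :=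
  IsCompletelySimple S ∧
    ∀ T₁ T₂ : Subsemigroup S, IsFGCompletelySimpleSub T₁ → IsFGCompletelySimpleSub T₂ →
      ∀ φ : T₁ ≃* T₂, ∃ Φ : S ≃* S, ∀ x : T₁, Φ (x : S) = (φ x : S)

/-- `G` is a homogeneous group: any isomorphism between finitely generated subgroups extends to an
automorphism of `G`. -/
def IsHomogeneousGroup (G : Type*) [Group G] : Prop :=
  ∀ H K : Subgroup G, H.FG → K.FG →
    ∀ φ : H ≃* K, ∃ Φ : G ≃* G, ∀ x : H, Φ (x : G) = (φ x : G)

/-!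
Write `H` for the set of matrix entries and `(i₀, l₀)` for the position at which the matrix is
normalised. The finitely generated completely simple subsemigroups used below are *boxes*
`J × A × M`, with `J` and `M` finite and `A` a finitely generated subgroup that contains the entries
of the `M × J` submatrix; an isomorphism between boxes has the form
`(i, g, l) ↦ (ψ i, u i * θ g * v l, χ l)` and exists whenever
`θ (P l i) = v l * P (χ l) (ψ i) * u i` (`exists_boxEquiv`).

If the semigroup is homogeneous, extending isomorphisms of boxes `{i₀} × A × {l₀}` makes `G`
homogeneous, and restricting automorphisms makes the subsemigroup generated by the idempotents
homogeneous. An automorphism that moves the idempotent `(i₀, 1, m)` to `(i₀, 1, l₀)` while acting as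
a given isomorphism `θ` on group coordinates sends the product `(i₀, P l i * (P m i)⁻¹, m)` of two
idempotents to a product of idempotents of the form `(i₀, P l' i', l₀)`; hence
`θ (P l i * (P m i)⁻¹)` is an entry (`map_mul_inv_mem_matrixEntries`). Fixing the entry in a maximal
subgroup and moving one index in `I` to another shows that every matrix column but `i₀` contains all
entries (`exists_entry_eq`). So `H` is closed under quotients and under automorphisms.

Conversely, let `H` be a characteristic subgroup; then the idempotents generate `I × H × Λ`. An
isomorphism `φ` of finitely generated subsemigroups restricts to an isomorphism of finitely
generated maximal subgroups, which extends to an automorphism `Θ` of `G`. Relative to `Θ`, the map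
`φ` is described by finite partial injections of `I` and `Λ` with factors in `H`. Keeping `Θ` fixed,
these extend to all of `I` and `Λ` by back and forth (`IsPartialSymmetry.exists_total`). The
one-step extension (`exists_extension_of_partial`) is homogeneity of `I × H × Λ`, applied to a box
whose subgroup `A` already contains the finitely many entries in the new rows and columns: the
automorphism obtained there agrees with `Θ` on `A`, hence on all entries that matter.

The row of a semigroup element `(i, g, l)` is `i`, which indexes a column of the matrix `P`, and its
column is `l`, which indexes a row of `P`.
-/

/-! ### Unary subsemigroups -/

section Unary

variable {S T : Type*} [Semigroup S] [Semigroup T]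

/-- A subsemigroup is closed under relative inverses. -/
def IsUnaryClosed (T : Subsemigroup S) : Prop :=
  ∀ a ∈ T, ∀ b : S, IsRelativeInverse a b → b ∈ T

lemma IsRelativeInverse.map (f : S →ₙ* T) {a b : S} (h : IsRelativeInverse a b) :
    IsRelativeInverse (f a) (f b) := by
  refine ⟨?_, ?_, ?_⟩
  · rw [← map_mul, ← map_mul, h.1]
  · rw [← map_mul, ← map_mul, h.2.1]
  · rw [← map_mul, ← map_mul, h.2.2]

lemma IsRelativeInverse.of_map (f : S →ₙ* T) (hf : Function.Injective f) {a b : S}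
    (h : IsRelativeInverse (f a) (f b)) : IsRelativeInverse a b := by
  refine ⟨hf ?_, hf ?_, hf ?_⟩
  · rw [map_mul, map_mul, h.1]
  · rw [map_mul, map_mul, h.2.1]
  · rw [map_mul, map_mul, h.2.2]

lemma subset_unaryClosure (X : Set S) : X ⊆ unaryClosure X := by
  intro x hx
  simp only [unaryClosure, SetLike.mem_coe, Subsemigroup.mem_sInf]
  exact fun T hT => hT.1 hx

lemma unaryClosure_isUnaryClosed (X : Set S) : IsUnaryClosed (unaryClosure X) := by
  intro a ha b hab
  simp only [unaryClosure, Subsemigroup.mem_sInf] at ha ⊢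
  exact fun T hT => hT.2 a (ha T hT) b hab

lemma unaryClosure_le {X : Set S} {T : Subsemigroup S} (h : X ⊆ T) (hT : IsUnaryClosed T) :
    unaryClosure X ≤ T :=
  sInf_le ⟨h, hT⟩

lemma map_unaryClosure (f : S →ₙ* T) (hf : Function.Injective f)
    (hr : ∀ a : S, ∀ b : T, IsRelativeInverse (f a) b → ∃ c, f c = b) (X : Set S) :
    (unaryClosure X).map f = unaryClosure (f '' X) := by
  apply le_antisymm
  · rw [Subsemigroup.map_le_iff_le_comap]
    apply unaryClosure_le
    · exact fun x hx => subset_unaryClosure _ ⟨x, hx, rfl⟩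
    · exact fun a ha b hab => unaryClosure_isUnaryClosed _ _ ha _ (hab.map f)
  · apply unaryClosure_le
    · rintro _ ⟨x, hx, rfl⟩
      exact ⟨x, subset_unaryClosure _ hx, rfl⟩
    · rintro _ ⟨a, ha, rfl⟩ b hab
      obtain ⟨c, rfl⟩ := hr a b hab
      exact ⟨c, unaryClosure_isUnaryClosed _ _ ha _ (hab.of_map f hf), rfl⟩

lemma IsUnaryClosed.map_subtype_unaryClosure {E : Subsemigroup S} (hE : IsUnaryClosed E)
    (X : Set E) :
    (unaryClosure X).map (MulMemClass.subtype E) = unaryClosure (Subtype.val '' X) :=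
  map_unaryClosure (MulMemClass.subtype E) Subtype.val_injective
    (fun a b hab => ⟨⟨b, hE a a.2 b hab⟩, rfl⟩) X

/-- The subsemigroup generated by the idempotents is invariant under automorphisms. -/
lemma map_idempotentGenerated (Φ : S ≃* S) :
    (idempotentGenerated S).map (Φ : S →ₙ* S) = idempotentGenerated S := by
  rw [idempotentGenerated, map_unaryClosure _ Φ.injective (fun _ b _ => Φ.surjective b)]
  congr 1
  ext e
  constructor
  · rintro ⟨x, hx, rfl⟩
    exact hx.map Φ
  · intro he
    exact ⟨Φ.symm e, IsIdempotentElem.map (he : IsIdempotentElem e) Φ.symm, by simp⟩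

end Unary

namespace ReesMatrixSemigroup

variable {G I Λ : Type*} [Group G] {P : Matrix Λ I G}

/-! ### Arithmetic in Rees matrix semigroups -/

@[simp] lemma row_mul (x y : ReesMatrixSemigroup P) : (x * y).row = x.row := rfl

@[simp] lemma col_mul (x y : ReesMatrixSemigroup P) : (x * y).col = y.col := rfl

@[simp] lemma val_mul (x y : ReesMatrixSemigroup P) :
    (x * y).val = x.val * P x.col y.row * y.val := rfl

@[simp] lemma mk_mul_mk (i j : I) (g h : G) (l m : Λ) :
    (⟨i, g, l⟩ * ⟨j, h, m⟩ : ReesMatrixSemigroup P) = ⟨i, g * P l j * h, m⟩ := rfl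

variable (P) in
/-- The identity of the maximal subgroup in row `i` and column `l`. -/
def idem (i : I) (l : Λ) : ReesMatrixSemigroup P := ⟨i, (P l i)⁻¹, l⟩

lemma isIdempotentElem_iff {x : ReesMatrixSemigroup P} :
    IsIdempotentElem x ↔ x = idem P x.row x.col := by
  obtain ⟨i, g, l⟩ := x
  constructor
  · intro h
    have h' : g * P l i * g = g := congrArg val h
    have : P l i * g = 1 := by
      rw [mul_assoc] at h'
      exact mul_eq_left.mp h'
    simp only [idem, mk.injEq, true_and, and_true]
    exact eq_inv_of_mul_eq_one_right this
  · intro h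
    simp only [idem, mk.injEq, true_and, and_true] at h
    subst h
    simp [IsIdempotentElem]

lemma isIdempotentElem_idem (i : I) (l : Λ) : IsIdempotentElem (idem P i l) :=
  isIdempotentElem_iff.mpr rfl

lemma idem_mul (x : ReesMatrixSemigroup P) (l : Λ) : idem P x.row l * x = x := by
  ext <;> simp [idem]

lemma mul_idem (x : ReesMatrixSemigroup P) (i : I) : x * idem P i x.col = x := by
  ext <;> simp [idem]

/-- The inverse of `x` in the maximal subgroup that contains `x`. -/
def relInv (x : ReesMatrixSemigroup P) : ReesMatrixSemigroup P :=
  ⟨x.row, (P x.col x.row)⁻¹ * x.val⁻¹ * (P x.col x.row)⁻¹, x.col⟩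

lemma mul_relInv (x : ReesMatrixSemigroup P) : x * x.relInv = idem P x.row x.col := by
  ext <;> simp [relInv, idem, mul_assoc]

lemma relInv_mul (x : ReesMatrixSemigroup P) : x.relInv * x = idem P x.row x.col := by
  ext <;> simp [relInv, idem, mul_assoc]

lemma isRelativeInverse_relInv (x : ReesMatrixSemigroup P) : IsRelativeInverse x x.relInv := by
  refine ⟨?_, ?_, ?_⟩
  · rw [mul_relInv, idem_mul]
  · rw [relInv_mul]
    exact idem_mul x.relInv _
  · rw [relInv_mul, mul_relInv]

lemma eq_relInv_of_isRelativeInverse {x y : ReesMatrixSemigroup P} (h : IsRelativeInverse x y) :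
    y = x.relInv := by
  have hr : y.row = x.row := by simpa using (congrArg row h.2.2).symm
  have hc : y.col = x.col := by simpa using congrArg col h.2.2
  have hv := congrArg val h.1
  simp only [val_mul, col_mul, hr, hc] at hv
  ext
  · exact hr
  · simp only [relInv]
    have : x.val * (P x.col x.row * y.val * P x.col x.row * x.val) = x.val * 1 := by
      rw [mul_one]; simpa only [mul_assoc] using hv
    have := mul_left_cancel this
    rw [eq_mul_inv_iff_mul_eq, eq_mul_inv_iff_mul_eq, eq_inv_iff_mul_eq_one]
    have h2 := congrArg (fun g => (P x.col x.row)⁻¹ * g * P x.col x.row) this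
    simpa [mul_assoc] using h2
  · exact hc

lemma isUnaryClosed_iff {T : Subsemigroup (ReesMatrixSemigroup P)} :
    IsUnaryClosed T ↔ ∀ x ∈ T, x.relInv ∈ T :=
  ⟨fun h x hx => h x hx _ x.isRelativeInverse_relInv,
    fun h x hx _ hy => eq_relInv_of_isRelativeInverse hy ▸ h x hx⟩

lemma idem_mem {T : Subsemigroup (ReesMatrixSemigroup P)} (hT : IsUnaryClosed T)
    {x y : ReesMatrixSemigroup P} (hx : x ∈ T) (hy : y ∈ T) : idem P x.row y.col ∈ T := by
  have h := T.mul_mem hx hy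
  have := T.mul_mem h (isUnaryClosed_iff.mp hT _ h)
  rwa [mul_relInv] at this

/-- A semigroup that embeds into a Rees matrix semigroup and has relative inverses is completely
simple. -/
lemma isCompletelySimple_of_injective {T : Type*} [Semigroup T] [Nonempty T]
    (f : T →ₙ* ReesMatrixSemigroup P) (hf : Function.Injective f)
    (hT : ∀ t : T, ∃ t' : T, f t' = (f t).relInv) : IsCompletelySimple T := by
  refine ⟨fun A hA => Set.eq_univ_of_forall fun t => ?_, ?_⟩
  · obtain ⟨⟨a, ha⟩, hA⟩ := hA
    -- `t * a * t` lies in the ideal and in the maximal subgroup of `t`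
    obtain ⟨y, hy⟩ := hT (t * a * t)
    have h1 : t * a * t ∈ A := (hA _ (hA a ha t).1 t).2
    have h2 : t * a * t * (y * t) = t := by
      apply hf
      rw [map_mul, map_mul f y, hy, ← mul_assoc, mul_relInv]
      simpa using idem_mul (f t) _
    exact h2 ▸ (hA _ h1 (y * t)).2
  · obtain ⟨t⟩ := ‹Nonempty T›
    obtain ⟨y, hy⟩ := hT t
    have he : f (t * y) = idem P (f t).row (f t).col := by rw [map_mul, hy, mul_relInv]
    refine ⟨t * y, ?_, ?_⟩
    · apply hf
      rw [map_mul, he]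
      exact isIdempotentElem_idem _ _
    · intro s hs h1 h2
      apply hf
      have hs' := isIdempotentElem_iff.mp (hs.map f)
      have h3 := congrArg (fun z => (f z).row) h1
      have h4 := congrArg (fun z => (f z).col) h2
      rw [map_mul, he] at h3 h4
      rw [he, hs', ← h3, ← h4]
      rfl

lemma isCompletelySimple [Nonempty I] [Nonempty Λ] :
    IsCompletelySimple (ReesMatrixSemigroup P) := by
  have : Nonempty (ReesMatrixSemigroup P) :=
    ⟨⟨Classical.arbitrary I, 1, Classical.arbitrary Λ⟩⟩
  exact isCompletelySimple_of_injective (MulHom.id _) Function.injective_id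
    (fun t => ⟨t.relInv, rfl⟩)

lemma isCompletelySimple_subsemigroup {T : Subsemigroup (ReesMatrixSemigroup P)}
    (hT : IsUnaryClosed T) (hne : (T : Set (ReesMatrixSemigroup P)).Nonempty) :
    IsCompletelySimple T := by
  have : Nonempty T := hne.to_subtype
  exact isCompletelySimple_of_injective (MulMemClass.subtype T) Subtype.val_injective
    (fun t => ⟨⟨_, isUnaryClosed_iff.mp hT t t.2⟩, rfl⟩)

lemma nonempty_of_isCompletelySimple {S : Type*} [Semigroup S] {T : Subsemigroup S}
    (hT : IsCompletelySimple T) : (T : Set S).Nonempty :=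
  hT.2.elim fun e _ => ⟨e, e.2⟩

lemma _root_.IsFGCompletelySimpleSub.isUnaryClosed {S : Type*} [Semigroup S]
    {T : Subsemigroup S} (hT : IsFGCompletelySimpleSub T) : IsUnaryClosed T := by
  obtain ⟨-, X, -, rfl⟩ := hT
  exact unaryClosure_isUnaryClosed X

/-! ### Finitely generated subsemigroups of a unary subsemigroup -/

section Sub

variable {E : Subsemigroup (ReesMatrixSemigroup P)}

/-- A finitely generated subsemigroup of `E`, regarded as a subsemigroup of the whole Rees matrix
semigroup. -/
lemma isFGCompletelySimpleSub_map (hE : IsUnaryClosed E) {T : Subsemigroup E}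
    (hT : IsFGCompletelySimpleSub T) :
    IsFGCompletelySimpleSub (T.map (MulMemClass.subtype E)) := by
  obtain ⟨hcs, X, hX, rfl⟩ := hT
  obtain ⟨x, hx⟩ := nonempty_of_isCompletelySimple hcs
  have heq := hE.map_subtype_unaryClosure X
  refine ⟨isCompletelySimple_subsemigroup ?_ ⟨x, x, hx, rfl⟩, _, hX.image _, heq⟩
  rw [heq]
  exact unaryClosure_isUnaryClosed _

lemma isFGCompletelySimpleSub_comap (hE : IsUnaryClosed E)
    {T : Subsemigroup (ReesMatrixSemigroup P)} (hT : IsFGCompletelySimpleSub T) (hTE : T ≤ E) :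
    IsFGCompletelySimpleSub (T.comap (MulMemClass.subtype E)) := by
  have hu := hT.isUnaryClosed
  obtain ⟨hcs, X, hX, rfl⟩ := hT
  obtain ⟨x, hx⟩ := nonempty_of_isCompletelySimple hcs
  constructor
  · have : Nonempty ((unaryClosure X).comap (MulMemClass.subtype E)) := ⟨⟨⟨x, hTE hx⟩, hx⟩⟩
    refine isCompletelySimple_of_injective
      ((MulMemClass.subtype E).comp (MulMemClass.subtype _))
      (Subtype.val_injective.comp Subtype.val_injective) ?_
    rintro ⟨⟨t, htE⟩, ht⟩
    exact ⟨⟨⟨t.relInv, isUnaryClosed_iff.mp hE t htE⟩, isUnaryClosed_iff.mp hu t ht⟩, rfl⟩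
  · refine ⟨Subtype.val ⁻¹' X, hX.preimage Subtype.val_injective.injOn, ?_⟩
    have hXE : X ⊆ E := (subset_unaryClosure X).trans hTE
    have h := hE.map_subtype_unaryClosure (Subtype.val ⁻¹' X)
    have hX' : Subtype.val '' (Subtype.val ⁻¹' X : Set E) = X :=
      Set.image_preimage_eq_of_subset (by simpa using hXE)
    rw [hX'] at h
    rw [← h]
    exact Subsemigroup.comap_map_eq_of_injective
      (f := MulMemClass.subtype E) Subtype.val_injective _

/-- Homogeneity of a unary subsemigroup `E`, in terms of subsemigroups of the ambient semigroup. -/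
lemma exists_extension_of_isHomogeneous (hE : IsUnaryClosed E)
    (hh : IsHomogeneousCompletelySimple E) {T₁ T₂ : Subsemigroup (ReesMatrixSemigroup P)}
    (h₁ : IsFGCompletelySimpleSub T₁) (h₂ : IsFGCompletelySimpleSub T₂) (hT₁ : T₁ ≤ E)
    (hT₂ : T₂ ≤ E) (φ : T₁ ≃* T₂) :
    ∃ Φ : E ≃* E, ∀ x : T₁, (Φ ⟨x, hT₁ x.2⟩ : ReesMatrixSemigroup P) = φ x := by
  let c (T : Subsemigroup (ReesMatrixSemigroup P)) (hT : T ≤ E) :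
      T.comap (MulMemClass.subtype E) ≃* T :=
    { toFun := fun x => ⟨x.1.1, x.2⟩
      invFun := fun x => ⟨⟨x.1, hT x.2⟩, x.2⟩
      left_inv := fun _ => rfl
      right_inv := fun _ => rfl
      map_mul' := fun _ _ => rfl }
  obtain ⟨Φ, hΦ⟩ := hh.2 _ _ (isFGCompletelySimpleSub_comap hE h₁ hT₁)
    (isFGCompletelySimpleSub_comap hE h₂ hT₂)
    (((c T₁ hT₁).trans φ).trans (c T₂ hT₂).symm)
  exact ⟨Φ, fun x => congrArg Subtype.val (hΦ ⟨⟨x, hT₁ x.2⟩, x.2⟩)⟩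

lemma isHomogeneous_idempotentGenerated [Nonempty I] [Nonempty Λ]
    (hS : IsHomogeneousCompletelySimple (ReesMatrixSemigroup P)) :
    IsHomogeneousCompletelySimple (idempotentGenerated (ReesMatrixSemigroup P)) := by
  have hE : IsUnaryClosed (idempotentGenerated (ReesMatrixSemigroup P)) :=
    unaryClosure_isUnaryClosed _
  refine ⟨isCompletelySimple_subsemigroup hE
    ⟨_, subset_unaryClosure _ (isIdempotentElem_idem (Classical.arbitrary I)
      (Classical.arbitrary Λ))⟩, fun T₁ T₂ h₁ h₂ φ => ?_⟩
  let e₁ := T₁.equivMapOfInjective (MulMemClass.subtype _) Subtype.val_injective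
  let e₂ := T₂.equivMapOfInjective (MulMemClass.subtype _) Subtype.val_injective
  obtain ⟨Φ, hΦ⟩ := hS.2 _ _ (isFGCompletelySimpleSub_map hE h₁)
    (isFGCompletelySimpleSub_map hE h₂) ((e₁.symm.trans φ).trans e₂)
  refine ⟨(Φ.subsemigroupMap _).trans (MulEquiv.subsemigroupCongr (map_idempotentGenerated Φ)),
    fun x => ?_⟩
  apply Subtype.ext
  have := hΦ (e₁ x)
  simp only [MulEquiv.trans_apply, MulEquiv.symm_apply_apply] at this
  exact this

end Sub

end ReesMatrixSemigroup

namespace ReesMatrixSemigroup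

variable {G I Λ : Type*} [Group G] {P : Matrix Λ I G}

/-- The maximal subgroup of `T` in row `i` and column `l`, as a subgroup of `G`: the element
`(i, p⁻¹ * g, l)` corresponds to `g`, where `p` is the matrix entry at `(l, i)`. -/
def maximalSubgroup {T : Subsemigroup (ReesMatrixSemigroup P)} (hT : IsUnaryClosed T)
    (i : I) (l : Λ) (h : idem P i l ∈ T) : Subgroup G where
  carrier := {g | (⟨i, (P l i)⁻¹ * g, l⟩ : ReesMatrixSemigroup P) ∈ T}
  one_mem' := by simpa [idem] using h
  mul_mem' := fun {a b} ha hb => by simpa [mul_assoc] using T.mul_mem ha hb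
  inv_mem' := fun {a} ha => by
    simpa [relInv, mul_assoc] using isUnaryClosed_iff.mp hT _ ha

/-! ### Boxes: subsemigroups `J × A × M` -/

/-- The subsemigroup `J × A × M` of a Rees matrix semigroup, for a subgroup `A` that contains the
entries of the `M × J` submatrix. -/
def box (J : Set I) (A : Subgroup G) (M : Set Λ) (h : ∀ l ∈ M, ∀ i ∈ J, P l i ∈ A) :
    Subsemigroup (ReesMatrixSemigroup P) where
  carrier := {x | x.row ∈ J ∧ x.val ∈ A ∧ x.col ∈ M}
  mul_mem' := fun hx hy =>
    ⟨hx.1, A.mul_mem (A.mul_mem hx.2.1 (h _ hx.2.2 _ hy.1)) hy.2.1, hy.2.2⟩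

section Box

variable {J : Set I} {A : Subgroup G} {M : Set Λ} {h : ∀ l ∈ M, ∀ i ∈ J, P l i ∈ A}

lemma box_isUnaryClosed : IsUnaryClosed (box J A M h) :=
  isUnaryClosed_iff.mpr fun _ hx =>
    have hp := A.inv_mem (h _ hx.2.2 _ hx.1)
    ⟨hx.1, A.mul_mem (A.mul_mem hp (A.inv_mem hx.2.1)) hp, hx.2.2⟩

lemma isFGCompletelySimpleSub_box (hJ : J.Finite) (hJ' : J.Nonempty) (hM : M.Finite)
    (hM' : M.Nonempty) (hA : A.FG) : IsFGCompletelySimpleSub (box J A M h) := by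
  obtain ⟨i₀, hi₀⟩ := hJ'
  obtain ⟨l₀, hl₀⟩ := hM'
  refine ⟨isCompletelySimple_subsemigroup box_isUnaryClosed ⟨⟨i₀, 1, l₀⟩, hi₀, A.one_mem, hl₀⟩, ?_⟩
  obtain ⟨s, rfl⟩ := hA
  let X : Set (ReesMatrixSemigroup P) :=
    (fun t : I × G × Λ => ⟨t.1, t.2.1, t.2.2⟩) '' (J ×ˢ (insert 1 (s : Set G)) ×ˢ M)
  have hX : ∀ i ∈ J, ∀ g ∈ insert 1 (s : Set G), ∀ l ∈ M,
      (⟨i, g, l⟩ : ReesMatrixSemigroup P) ∈ unaryClosure X := fun i hi g hg l hl =>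
    subset_unaryClosure X ⟨(i, g, l), ⟨hi, hg, hl⟩, rfl⟩
  have hu := unaryClosure_isUnaryClosed X
  refine ⟨X, (hJ.prod ((s.finite_toSet.insert 1).prod hM)).image _, le_antisymm ?_ ?_⟩
  · have h1 := hX i₀ hi₀ 1 (by simp) l₀ hl₀
    let B : Subgroup G := maximalSubgroup hu i₀ l₀ (idem_mem hu h1 h1)
    have hB : ∀ g ∈ insert 1 (s : Set G), P l₀ i₀ * g ∈ B := fun g hg => by
      change (⟨i₀, (P l₀ i₀)⁻¹ * (P l₀ i₀ * g), l₀⟩ : ReesMatrixSemigroup P) ∈ unaryClosure X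
      rw [inv_mul_cancel_left]
      exact hX i₀ hi₀ g hg l₀ hl₀
    have hp : P l₀ i₀ ∈ B := by simpa using hB 1 (by simp)
    have hle : Subgroup.closure (s : Set G) ≤ B := by
      rw [Subgroup.closure_le]
      intro g hg
      simpa using B.mul_mem (B.inv_mem hp) (hB g (by simp [Finset.mem_coe.mp hg]))
    intro x hx
    have hxB : x.val * (P l₀ i₀)⁻¹ ∈ B := B.mul_mem (hle hx.2.1) (B.inv_mem hp)
    have := (unaryClosure X).mul_mem ((unaryClosure X).mul_mem
      (hX x.row hx.1 1 (by simp) l₀ hl₀) hxB) (hX i₀ hi₀ 1 (by simp) x.col hx.2.2)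
    simpa using this
  · apply unaryClosure_le _ box_isUnaryClosed
    rintro _ ⟨⟨i, g, l⟩, ⟨hi, hg, hl⟩, rfl⟩
    refine ⟨hi, ?_, hl⟩
    rcases hg with rfl | hg
    · exact Subgroup.one_mem _
    · exact Subgroup.subset_closure hg

/-- An isomorphism `θ` of subgroups, injections of the index sets and factors `u`, `v` that
intertwine the matrix entries induce an isomorphism between boxes. -/
lemma exists_boxEquiv {B : Subgroup G} (θ : A ≃* B) {ψ : I → I} {χ : Λ → Λ} {u : I → G} {v : Λ → G}
    (hψ : Set.InjOn ψ J) (hχ : Set.InjOn χ M) (hu : ∀ i ∈ J, u i ∈ B) (hv : ∀ l ∈ M, v l ∈ B)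
    (heq : ∀ l (hl : l ∈ M) i (hi : i ∈ J),
      (θ ⟨P l i, h l hl i hi⟩ : G) = v l * P (χ l) (ψ i) * u i) :
    ∃ (h' : ∀ l ∈ χ '' M, ∀ i ∈ ψ '' J, P l i ∈ B)
      (φ : box J A M h ≃* box (ψ '' J) B (χ '' M) h'),
      ∀ x : box J A M h, (φ x : ReesMatrixSemigroup P) =
        ⟨ψ x.1.row, u x.1.row * θ ⟨x.1.val, x.2.2.1⟩ * v x.1.col, χ x.1.col⟩ := by
  have h' : ∀ l ∈ χ '' M, ∀ i ∈ ψ '' J, P l i ∈ B := by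
    rintro _ ⟨l, hl, rfl⟩ _ ⟨i, hi, rfl⟩
    have : P (χ l) (ψ i) = (v l)⁻¹ * θ ⟨P l i, h l hl i hi⟩ * (u i)⁻¹ := by
      rw [heq l hl i hi]; group
    rw [this]
    exact B.mul_mem (B.mul_mem (B.inv_mem (hv l hl)) (θ _).2) (B.inv_mem (hu i hi))
  let f : box J A M h →ₙ* box (ψ '' J) B (χ '' M) h' :=
    { toFun := fun x =>
        ⟨⟨ψ x.1.row, u x.1.row * θ ⟨x.1.val, x.2.2.1⟩ * v x.1.col, χ x.1.col⟩,
          ⟨_, x.2.1, rfl⟩,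
          B.mul_mem (B.mul_mem (hu _ x.2.1) (θ _).2) (hv _ x.2.2.2), ⟨_, x.2.2.2, rfl⟩⟩
      map_mul' := fun x y => by
        have hm : (θ ⟨(x * y).1.val, (x * y).2.2.1⟩ : G) =
            θ ⟨x.1.val, x.2.2.1⟩ * θ ⟨P x.1.col y.1.row, h _ x.2.2.2 _ y.2.1⟩ *
              θ ⟨y.1.val, y.2.2.1⟩ := by
          rw [← Subgroup.coe_mul, ← Subgroup.coe_mul, ← map_mul, ← map_mul]
          rfl
        apply Subtype.ext
        ext
        · rfl
        · change u x.1.row * _ * v y.1.col = _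
          rw [hm, heq _ x.2.2.2 _ y.2.1]
          change _ = (u x.1.row * _ * v x.1.col) * P (χ x.1.col) (ψ y.1.row) *
            (u y.1.row * _ * v y.1.col)
          simp only [mul_assoc]
        · rfl }
  have hf : Function.Bijective f := by
    constructor
    · rintro ⟨⟨i, a, l⟩, hi, ha, hl⟩ ⟨⟨j, b, m⟩, hj, hb, hm⟩ hxy
      have hxy := congrArg Subtype.val hxy
      have h1 : i = j := hψ hi hj (congrArg row hxy)
      have h3 : l = m := hχ hl hm (congrArg col hxy)
      subst h1 h3
      have h2 : u i * (θ ⟨a, ha⟩ : G) * v l = u i * θ ⟨b, hb⟩ * v l := congrArg val hxy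
      have h4 := θ.injective (Subtype.ext (mul_left_cancel (mul_right_cancel h2)))
      obtain rfl : a = b := congrArg Subtype.val h4
      rfl
    · rintro ⟨⟨i', b, l'⟩, hi', hb, hl'⟩
      obtain ⟨i, hi, rfl⟩ : ∃ i ∈ J, ψ i = i' := hi'
      obtain ⟨l, hl, rfl⟩ : ∃ l ∈ M, χ l = l' := hl'
      have hb' : (u i)⁻¹ * b * (v l)⁻¹ ∈ B :=
        B.mul_mem (B.mul_mem (B.inv_mem (hu i hi)) hb) (B.inv_mem (hv l hl))
      refine ⟨⟨⟨i, θ.symm ⟨_, hb'⟩, l⟩, hi, (θ.symm _).2, hl⟩, ?_⟩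
      apply Subtype.ext
      ext
      · rfl
      · change u i * (θ (θ.symm ⟨_, hb'⟩) : G) * v l = b
        rw [MulEquiv.apply_symm_apply]
        group
      · rfl
  exact ⟨h', MulEquiv.ofBijective f hf, fun _ => rfl⟩

end Box

/-! ### Consequences of homogeneity -/

section Homogeneous

variable {i₀ : I} {l₀ : Λ}

lemma _root_.MulEquiv.fg_of_fg {A B : Subgroup G} (θ : A ≃* B) (hA : A.FG) : B.FG := by
  rw [← Group.fg_iff_subgroup_fg] at hA ⊢
  exact Group.fg_of_surjective (f := θ.toMonoidHom) θ.surjective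

/-- In a homogeneous Rees matrix semigroup, an isomorphism of finitely generated subgroups and
injections of finite index sets whose matrix entries are trivial are induced by an automorphism. -/
lemma exists_aut_of_trivial_entries (hS : IsHomogeneousCompletelySimple (ReesMatrixSemigroup P))
    {J : Set I} {M : Set Λ} (hJ : J.Finite) (hJ' : J.Nonempty) (hM : M.Finite)
    (hM' : M.Nonempty) {A B : Subgroup G} (hA : A.FG) (θ : A ≃* B) {ψ : I → I} {χ : Λ → Λ}
    (hψ : Set.InjOn ψ J) (hχ : Set.InjOn χ M) (h : ∀ l ∈ M, ∀ i ∈ J, P l i = 1)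
    (h' : ∀ l ∈ M, ∀ i ∈ J, P (χ l) (ψ i) = 1) :
    ∃ Φ : ReesMatrixSemigroup P ≃* ReesMatrixSemigroup P,
      ∀ i ∈ J, ∀ l ∈ M, ∀ a : A, Φ ⟨i, a, l⟩ = ⟨ψ i, θ a, χ l⟩ := by
  have hPA : ∀ l ∈ M, ∀ i ∈ J, P l i ∈ A := fun l hl i hi => (h l hl i hi) ▸ A.one_mem
  obtain ⟨hB, φ, hφ⟩ := exists_boxEquiv (h := hPA) θ (u := fun _ => 1) (v := fun _ => 1) hψ hχ
    (fun _ _ => B.one_mem) (fun _ _ => B.one_mem) (fun l hl i hi => by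
      have : (⟨P l i, hPA l hl i hi⟩ : A) = 1 := Subtype.ext (h l hl i hi)
      rw [this, map_one, h' l hl i hi]
      simp)
  obtain ⟨Φ, hΦ⟩ := hS.2 _ _ (isFGCompletelySimpleSub_box hJ hJ' hM hM' hA)
    (isFGCompletelySimpleSub_box (hJ.image ψ) (hJ'.image ψ) (hM.image χ) (hM'.image χ)
      (θ.fg_of_fg hA)) φ
  refine ⟨Φ, fun i hi l hl a => ?_⟩
  rw [hΦ ⟨⟨i, a, l⟩, hi, a.2, hl⟩, hφ]
  simp

/-- An automorphism that fixes row `i₀` permutes the idempotents in that row. -/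
lemma map_idempotent_of_row (hcol : ∀ l : Λ, P l i₀ = 1)
    {Φ : ReesMatrixSemigroup P ≃* ReesMatrixSemigroup P} {m : Λ}
    (h : Φ ⟨i₀, 1, m⟩ = ⟨i₀, 1, l₀⟩) (l : Λ) :
    Φ ⟨i₀, 1, l⟩ = ⟨i₀, 1, (Φ ⟨i₀, 1, l⟩).col⟩ := by
  have hi : IsIdempotentElem (⟨i₀, 1, l⟩ : ReesMatrixSemigroup P) := by
    rw [isIdempotentElem_iff]; simp [idem, hcol]
  have h2 := isIdempotentElem_iff.mp (hi.map Φ)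
  have h3 : (⟨i₀, 1, m⟩ * ⟨i₀, 1, l⟩ : ReesMatrixSemigroup P) = ⟨i₀, 1, l⟩ := by simp [hcol]
  have h4 : (Φ ⟨i₀, 1, l⟩).row = i₀ := by
    rw [← h3, map_mul, h]; rfl
  rw [idem, h4, hcol, inv_one] at h2
  exact h2

lemma isHomogeneousGroup (l₀ : Λ) (hcol : ∀ l : Λ, P l i₀ = 1)
    (hS : IsHomogeneousCompletelySimple (ReesMatrixSemigroup P)) :
    IsHomogeneousGroup G := by
  intro A B hA _ θ
  obtain ⟨Φ, hΦ⟩ := exists_aut_of_trivial_entries hS (Set.finite_singleton i₀) ⟨i₀, rfl⟩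
    (Set.finite_singleton l₀) ⟨l₀, rfl⟩ hA θ (ψ := id) (χ := id) (Set.injOn_id _) (Set.injOn_id _)
    (fun l _ i hi => hi ▸ hcol l) (fun l _ i hi => hi ▸ hcol l)
  have h1 : Φ ⟨i₀, 1, l₀⟩ = ⟨i₀, 1, l₀⟩ := by simpa using hΦ i₀ rfl l₀ rfl 1
  -- an automorphism that fixes an idempotent acts on its maximal subgroup
  have key : ∀ Ψ : ReesMatrixSemigroup P ≃* ReesMatrixSemigroup P,
      Ψ ⟨i₀, 1, l₀⟩ = ⟨i₀, 1, l₀⟩ → ∀ g, Ψ ⟨i₀, g, l₀⟩ = ⟨i₀, (Ψ ⟨i₀, g, l₀⟩).val, l₀⟩ := by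
    intro Ψ hΨ g
    have : (⟨i₀, g, l₀⟩ : ReesMatrixSemigroup P) = ⟨i₀, 1, l₀⟩ * ⟨i₀, g, l₀⟩ * ⟨i₀, 1, l₀⟩ := by
      simp [hcol]
    have h2 := congrArg Ψ this
    rw [map_mul, map_mul, hΨ] at h2
    ext
    · simpa using congrArg row h2
    · rfl
    · simpa using congrArg col h2
  have h1' : Φ.symm ⟨i₀, 1, l₀⟩ = ⟨i₀, 1, l₀⟩ := by rw [MulEquiv.symm_apply_eq, h1]
  refine ⟨{ toFun := fun g => (Φ ⟨i₀, g, l₀⟩).val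
            invFun := fun g => (Φ.symm ⟨i₀, g, l₀⟩).val
            left_inv := fun g => ?_
            right_inv := fun g => ?_
            map_mul' := fun g h => ?_ }, fun x => ?_⟩
  · simp only
    rw [← key Φ h1, MulEquiv.symm_apply_apply]
  · simp only
    rw [← key Φ.symm h1', MulEquiv.apply_symm_apply]
  · have : (⟨i₀, g * h, l₀⟩ : ReesMatrixSemigroup P) = ⟨i₀, g, l₀⟩ * ⟨i₀, h, l₀⟩ := by
      simp [hcol]
    rw [this, map_mul, key Φ h1 g, key Φ h1 h]
    simp [hcol]
  · exact congrArg val (hΦ i₀ rfl l₀ rfl x)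

/-- Isomorphisms of finitely generated subgroups preserve the quotients of two entries in a
column, up to membership in the set of entries. -/
lemma map_mul_inv_mem_matrixEntries (hcol : ∀ l : Λ, P l i₀ = 1) (hrow : ∀ i : I, P l₀ i = 1)
    (hS : IsHomogeneousCompletelySimple (ReesMatrixSemigroup P)) {A B : Subgroup G} (hA : A.FG)
    (θ : A ≃* B) {l m : Λ} {i : I} (hmem : P l i * (P m i)⁻¹ ∈ A) :
    (θ ⟨_, hmem⟩ : G) ∈ matrixEntries P := by
  -- move the idempotent `(i₀, 1, m)` to `(i₀, 1, l₀)`, with `θ` on the maximal subgroup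
  obtain ⟨Φ, hΦ⟩ := exists_aut_of_trivial_entries hS (Set.finite_singleton i₀) ⟨i₀, rfl⟩
    (Set.finite_singleton m) ⟨m, rfl⟩ hA θ (ψ := id) (χ := fun _ => l₀) (Set.injOn_id _)
    (Set.injOn_singleton _ _) (fun l _ i hi => hi ▸ hcol l) (fun l _ i hi => hi ▸ hcol l₀)
  have h1 : Φ ⟨i₀, 1, m⟩ = ⟨i₀, 1, l₀⟩ := by simpa using hΦ i₀ rfl m rfl 1
  have hx := map_idempotent_of_row hcol h1 l
  have hy : Φ (idem P i m) = ⟨(Φ (idem P i m)).row, 1, l₀⟩ := by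
    have h2 := isIdempotentElem_iff.mp ((isIdempotentElem_idem (P := P) i m).map Φ)
    have h3 : idem P i m * ⟨i₀, 1, m⟩ = idem P i m := by simp [hcol, idem]
    have h4 : (Φ (idem P i m)).col = l₀ := by
      rw [← h3, map_mul, h1]; rfl
    rw [h4] at h2
    rw [h2]
    simp [idem, hrow]
  have hxy : (⟨i₀, 1, l⟩ : ReesMatrixSemigroup P) * idem P i m = ⟨i₀, P l i * (P m i)⁻¹, m⟩ := by
    simp [idem]
  refine ⟨(Φ ⟨i₀, 1, l⟩).col, (Φ (idem P i m)).row, ?_⟩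
  have h5 := hΦ i₀ rfl m rfl ⟨_, hmem⟩
  rw [← hxy, map_mul, hx, hy] at h5
  simpa using congrArg val h5

lemma mul_inv_mem_matrixEntries (hcol : ∀ l : Λ, P l i₀ = 1) (hrow : ∀ i : I, P l₀ i = 1)
    (hS : IsHomogeneousCompletelySimple (ReesMatrixSemigroup P))
    (l m : Λ) (i : I) : P l i * (P m i)⁻¹ ∈ matrixEntries P :=
  map_mul_inv_mem_matrixEntries hcol hrow hS (A := Subgroup.zpowers (P l i * (P m i)⁻¹))
    ⟨{P l i * (P m i)⁻¹}, by simp [Subgroup.zpowers_eq_closure]⟩ (MulEquiv.refl _)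
    (Subgroup.mem_zpowers _)

/-- Every column other than the trivial column `i₀` contains every matrix entry. -/
lemma exists_entry_eq (hcol : ∀ l : Λ, P l i₀ = 1) (hrow : ∀ i : I, P l₀ i = 1)
    (hS : IsHomogeneousCompletelySimple (ReesMatrixSemigroup P)) {i : I}
    (hi : i ≠ i₀) (l : Λ) (j : I) : ∃ m, P m i = P l j := by
  classical
  by_cases hj : j = i₀
  · exact ⟨l₀, by rw [hrow, hj, hcol]⟩
  -- fix `P l j` in the maximal subgroup at `(i₀, l₀)` and move row `j` to row `i`
  have hψ : Set.InjOn (fun k => if k = i₀ then i₀ else i) {i₀, j} := by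
    rintro a (rfl | rfl) b (rfl | rfl) hab <;> simp_all
  obtain ⟨Φ, hΦ⟩ := exists_aut_of_trivial_entries hS (J := {i₀, j}) (Set.toFinite _)
    ⟨i₀, by simp⟩ (Set.finite_singleton l₀) ⟨l₀, rfl⟩ (A := Subgroup.zpowers (P l j))
    ⟨{P l j}, by simp [Subgroup.zpowers_eq_closure]⟩ (MulEquiv.refl _) (χ := id)
    hψ (Set.injOn_id _) (fun l hl i _ => by rw [Set.mem_singleton_iff.mp hl, hrow])
    (fun l hl i _ => by rw [Set.mem_singleton_iff.mp hl, id, hrow])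
  have h1 : Φ ⟨i₀, 1, l₀⟩ = ⟨i₀, 1, l₀⟩ := by simpa using hΦ i₀ (by simp) l₀ rfl 1
  have hy : Φ ⟨j, 1, l₀⟩ = ⟨i, 1, l₀⟩ := by simpa [hj] using hΦ j (by simp) l₀ rfl 1
  have hx := map_idempotent_of_row hcol h1 l
  have hxy : (⟨i₀, 1, l⟩ : ReesMatrixSemigroup P) * ⟨j, 1, l₀⟩ = ⟨i₀, P l j, l₀⟩ := by simp
  have h5 := hΦ i₀ (by simp) l₀ rfl ⟨P l j, Subgroup.mem_zpowers _⟩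
  rw [← hxy, map_mul, hx, hy] at h5
  exact ⟨_, by simpa using congrArg val h5⟩

lemma exists_characteristic_subgroup (hcol : ∀ l : Λ, P l i₀ = 1) (hrow : ∀ i : I, P l₀ i = 1)
    (hS : IsHomogeneousCompletelySimple (ReesMatrixSemigroup P)) :
    ∃ H : Subgroup G, (H : Set G) = matrixEntries P ∧ H.Characteristic := by
  have hinv : ∀ g ∈ matrixEntries P, g⁻¹ ∈ matrixEntries P := by
    rintro _ ⟨l, i, rfl⟩
    simpa [hrow] using mul_inv_mem_matrixEntries hcol hrow hS l₀ l i
  have hdiv : ∀ g ∈ matrixEntries P, ∀ h ∈ matrixEntries P, g * h⁻¹ ∈ matrixEntries P := by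
    rintro _ ⟨l, i, rfl⟩ _ ⟨m, j, rfl⟩
    by_cases hi : i = i₀
    · rw [hi, hcol, one_mul]
      exact hinv _ ⟨m, j, rfl⟩
    · obtain ⟨k, hk⟩ := exists_entry_eq hcol hrow hS hi m j
      rw [← hk]
      exact mul_inv_mem_matrixEntries hcol hrow hS l k i
  let H : Subgroup G :=
    { carrier := matrixEntries P
      one_mem' := ⟨l₀, i₀, hcol l₀⟩
      mul_mem' := fun {a b} ha hb => by simpa using hdiv a ha _ (hinv b hb)
      inv_mem' := fun {a} ha => hinv a ha }
  refine ⟨H, rfl, Subgroup.characteristic_iff_map_le.mpr fun θ => ?_⟩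
  rintro _ ⟨_, ⟨l, i, rfl⟩, rfl⟩
  have hmem : P l i * (P l₀ i)⁻¹ ∈ Subgroup.zpowers (P l i) := by
    rw [hrow, inv_one, mul_one]
    exact Subgroup.mem_zpowers _
  have := map_mul_inv_mem_matrixEntries hcol hrow hS (A := Subgroup.zpowers (P l i))
    ⟨{P l i}, by simp [Subgroup.zpowers_eq_closure]⟩ (θ.subgroupMap _) hmem
  simp only [MulEquiv.coe_subgroupMap_apply, hrow, inv_one, mul_one] at this
  exact this

end Homogeneous

end ReesMatrixSemigroup

namespace ReesMatrixSemigroup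

variable {G I Λ : Type*} [Group G] {P : Matrix Λ I G}

/-! ### Isomorphisms between unary subsemigroups -/

section Isomorphism

variable {T₁ T₂ : Subsemigroup (ReesMatrixSemigroup P)}

lemma row_eq_of_row_map_eq (h₂ : IsUnaryClosed T₂) (φ : T₁ ≃* T₂) {x y : T₁}
    (h : (φ x).1.row = (φ y).1.row) : x.1.row = y.1.row := by
  -- `φ y` is a right multiple of `φ x`, hence `y` is one of `x`
  let t : T₂ := ⟨_, isUnaryClosed_iff.mp h₂ _ (φ x).2⟩ * φ y
  have h1 : φ x * t = φ y := by
    apply Subtype.ext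
    change (φ x).1 * ((φ x).1.relInv * (φ y).1) = (φ y).1
    rw [← mul_assoc, mul_relInv, h, idem_mul]
  have h2 : x * φ.symm t = y := by
    apply φ.injective
    rw [map_mul, MulEquiv.apply_symm_apply, h1]
  rw [← h2]
  rfl

lemma col_eq_of_col_map_eq (h₂ : IsUnaryClosed T₂) (φ : T₁ ≃* T₂) {x y : T₁}
    (h : (φ x).1.col = (φ y).1.col) : x.1.col = y.1.col := by
  let t : T₂ := φ y * ⟨_, isUnaryClosed_iff.mp h₂ _ (φ x).2⟩
  have h1 : t * φ x = φ y := by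
    apply Subtype.ext
    change (φ y).1 * (φ x).1.relInv * (φ x).1 = (φ y).1
    rw [mul_assoc, relInv_mul, h, mul_idem]
  have h2 : φ.symm t * x = y := by
    apply φ.injective
    rw [map_mul, MulEquiv.apply_symm_apply, h1]
  rw [← h2]
  rfl

lemma row_map_eq_of_row_eq (h₁ : IsUnaryClosed T₁) (φ : T₁ ≃* T₂) {x y : T₁}
    (h : x.1.row = y.1.row) : (φ x).1.row = (φ y).1.row :=
  row_eq_of_row_map_eq h₁ φ.symm (by simpa using h)

lemma col_map_eq_of_col_eq (h₁ : IsUnaryClosed T₁) (φ : T₁ ≃* T₂) {x y : T₁}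
    (h : x.1.col = y.1.col) : (φ x).1.col = (φ y).1.col :=
  col_eq_of_col_map_eq h₁ φ.symm (by simpa using h)

/-- The automorphism `(i, g, l) ↦ (ψ i, u i * Θ g * v l, χ l)` of a Rees matrix semigroup. -/
def autOf (Θ : G ≃* G) (ψ : I ≃ I) (χ : Λ ≃ Λ) (u : I → G) (v : Λ → G)
    (h : ∀ l i, Θ (P l i) = v l * P (χ l) (ψ i) * u i) :
    ReesMatrixSemigroup P ≃* ReesMatrixSemigroup P where
  toFun x := ⟨ψ x.row, u x.row * Θ x.val * v x.col, χ x.col⟩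
  invFun x := ⟨ψ.symm x.row,
    Θ.symm ((u (ψ.symm x.row))⁻¹ * x.val * (v (χ.symm x.col))⁻¹), χ.symm x.col⟩
  left_inv x := by ext <;> simp [mul_assoc]
  right_inv x := by ext <;> simp [mul_assoc]
  map_mul' x y := by ext <;> simp [mul_assoc, h]

end Isomorphism

/-! ### The one-step extension property -/

section Step

variable {i₀ : I} {l₀ : Λ} {H : Subgroup G}

lemma entry_mem (hH : (H : Set G) = matrixEntries P) (l : Λ) (i : I) : P l i ∈ H := by
  rw [← SetLike.mem_coe, hH]
  exact ⟨l, i, rfl⟩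

/-- If the matrix entries form a subgroup `H`, the idempotents generate `I × H × Λ`. -/
lemma mem_idempotentGenerated_iff (hcol : ∀ l : Λ, P l i₀ = 1) (hrow : ∀ i : I, P l₀ i = 1)
    (hH : (H : Set G) = matrixEntries P) {x : ReesMatrixSemigroup P} :
    x ∈ idempotentGenerated (ReesMatrixSemigroup P) ↔ x.val ∈ H := by
  constructor
  · intro hx
    have hle : idempotentGenerated (ReesMatrixSemigroup P) ≤
        box Set.univ H Set.univ (fun l _ i _ => entry_mem hH l i) := by
      apply unaryClosure_le _ box_isUnaryClosed
      intro e he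
      rw [isIdempotentElem_iff.mp he]
      exact ⟨trivial, H.inv_mem (entry_mem hH _ _), trivial⟩
    exact (hle hx).2.1
  · intro hx
    rw [← SetLike.mem_coe, hH] at hx
    obtain ⟨l, i, hli⟩ := hx
    have he : ∀ (j : I) (m : Λ), P m j = 1 →
        (⟨j, 1, m⟩ : ReesMatrixSemigroup P) ∈ idempotentGenerated (ReesMatrixSemigroup P) :=
      fun j m h => subset_unaryClosure _ (by
        change IsIdempotentElem _
        rw [isIdempotentElem_iff]
        simp [idem, h])
    have h1 : x = (⟨x.row, 1, l₀⟩ * ⟨i₀, 1, l⟩) * (⟨i, 1, l₀⟩ * ⟨i₀, 1, x.col⟩) := by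
      ext <;> simp [hcol, hli]
    rw [h1]
    exact mul_mem (mul_mem (he _ _ (hrow _)) (he _ _ (hcol _)))
      (mul_mem (he _ _ (hrow _)) (he _ _ (hcol _)))

/-- A finite partial symmetry of the matrix over a fixed automorphism `Θ` of the group extends to
larger finite sets of rows and columns. It is an isomorphism between boxes in the subsemigroup
generated by the idempotents; the larger entries are put into the subgroup of the box, so that
`Θ` and the automorphism supplied by homogeneity agree on them. -/
lemma exists_extension_of_partial (hcol : ∀ l : Λ, P l i₀ = 1) (hrow : ∀ i : I, P l₀ i = 1)
    (hH : (H : Set G) = matrixEntries P)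
    (hE : IsHomogeneousCompletelySimple (idempotentGenerated (ReesMatrixSemigroup P)))
    (Θ : G ≃* G) (hΘ : ∀ g, Θ g ∈ H ↔ g ∈ H) {J J' : Set I} {M M' : Set Λ}
    (hJ' : J'.Finite) (hM' : M'.Finite) (hJJ : J ⊆ J') (hMM : M ⊆ M') (hJ : J.Nonempty)
    (hM : M.Nonempty) {ψ : I → I} {χ : Λ → Λ} {u : I → G} {v : Λ → G}
    (hψ : Set.InjOn ψ J) (hχ : Set.InjOn χ M) (hu : ∀ i ∈ J, u i ∈ H) (hv : ∀ l ∈ M, v l ∈ H)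
    (heq : ∀ l ∈ M, ∀ i ∈ J, Θ (P l i) = v l * P (χ l) (ψ i) * u i) :
    ∃ (ψ' : I → I) (χ' : Λ → Λ) (u' : I → G) (v' : Λ → G),
      Function.Injective ψ' ∧ Function.Injective χ' ∧ (∀ i, u' i ∈ H) ∧ (∀ l, v' l ∈ H) ∧
      (∀ i ∈ J, ψ' i = ψ i ∧ u' i = u i) ∧ (∀ l ∈ M, χ' l = χ l ∧ v' l = v l) ∧
      ∀ l ∈ M', ∀ i ∈ J', Θ (P l i) = v' l * P (χ' l) (ψ' i) * u' i := by
  set E := idempotentGenerated (ReesMatrixSemigroup P)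
  have hEu : IsUnaryClosed E := unaryClosure_isUnaryClosed _
  have hmem : ∀ {x : ReesMatrixSemigroup P}, x ∈ E ↔ x.val ∈ H :=
    mem_idempotentGenerated_iff hcol hrow hH
  let X : Set G := (Set.image2 P M' J' ∪ (fun i => Θ.symm (u i)) '' J) ∪
    (fun l => Θ.symm (v l)) '' M
  have hXfin : X.Finite := ((hM'.image2 _ hJ').union ((hJ'.subset hJJ).image _)).union
    ((hM'.subset hMM).image _)
  let A : Subgroup G := Subgroup.closure X
  have hAfg : A.FG := (Subgroup.fg_iff A).mpr ⟨X, rfl, hXfin⟩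
  have hAH : A ≤ H := by
    rw [Subgroup.closure_le]
    rintro _ ((⟨l, -, i, -, rfl⟩ | ⟨i, hi, rfl⟩) | ⟨l, hl, rfl⟩)
    · exact entry_mem hH l i
    · exact (hΘ _).mp (by simpa using hu i hi)
    · exact (hΘ _).mp (by simpa using hv l hl)
  have hPA : ∀ l ∈ M', ∀ i ∈ J', P l i ∈ A := fun l hl i hi =>
    Subgroup.subset_closure (Or.inl (Or.inl ⟨l, hl, i, hi, rfl⟩))
  have hPA' : ∀ l ∈ M, ∀ i ∈ J, P l i ∈ A := fun l hl i hi => hPA l (hMM hl) i (hJJ hi)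
  have huB : ∀ i ∈ J, u i ∈ A.map (Θ : G →* G) := fun i hi =>
    ⟨Θ.symm (u i), Subgroup.subset_closure (Or.inl (Or.inr ⟨i, hi, rfl⟩)), by simp⟩
  have hvB : ∀ l ∈ M, v l ∈ A.map (Θ : G →* G) := fun l hl =>
    ⟨Θ.symm (v l), Subgroup.subset_closure (Or.inr ⟨l, hl, rfl⟩), by simp⟩
  obtain ⟨hB, φ, hφ⟩ := exists_boxEquiv (h := hPA') (Θ.subgroupMap A) hψ hχ huB hvB
    (fun l hl i hi => heq l hl i hi)
  have hJf := hJ'.subset hJJ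
  have hMf := hM'.subset hMM
  have hbox : box J A M hPA' ≤ E := fun x hx => hmem.mpr (hAH hx.2.1)
  obtain ⟨Φ, hΦ⟩ := exists_extension_of_isHomogeneous hEu hE
    (isFGCompletelySimpleSub_box hJf hJ hMf hM hAfg)
    (isFGCompletelySimpleSub_box (hJf.image ψ) (hJ.image ψ) (hMf.image χ) (hM.image χ)
      ((Θ.subgroupMap A).fg_of_fg hAfg))
    hbox
    (by
      rintro x ⟨-, ⟨a, ha, hax⟩, -⟩
      rw [hmem, ← hax]
      exact (hΘ a).mpr (hAH ha)) φ
  -- new rows and columns are read off the images of `(i, 1, m)` and `(j, 1, l)`, where `j ∈ J`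
  -- and `m ∈ M` are fixed
  have hΦ' : ∀ i ∈ J, ∀ l ∈ M, ∀ a ∈ A, ∀ h : (⟨i, a, l⟩ : ReesMatrixSemigroup P) ∈ E,
      (Φ ⟨⟨i, a, l⟩, h⟩ : ReesMatrixSemigroup P) = ⟨ψ i, u i * Θ a * v l, χ l⟩ :=
    fun i hi l hl a ha h => (hΦ ⟨⟨i, a, l⟩, hi, ha, hl⟩).trans (hφ _)
  obtain ⟨j, hj⟩ := hJ
  obtain ⟨m, hm⟩ := hM
  let q (i : I) : E := ⟨⟨i, 1, m⟩, hmem.mpr H.one_mem⟩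
  let r (l : Λ) : E := ⟨⟨j, 1, l⟩, hmem.mpr H.one_mem⟩
  have hq : ∀ i ∈ J, (Φ (q i)).1 = ⟨ψ i, u i * v m, χ m⟩ := fun i hi => by
    have := hΦ' i hi m hm 1 A.one_mem (hmem.mpr H.one_mem)
    rwa [map_one, mul_one] at this
  have hr : ∀ l ∈ M, (Φ (r l)).1 = ⟨ψ j, u j * v l, χ l⟩ := fun l hl => by
    have := hΦ' j hj l hl 1 A.one_mem (hmem.mpr H.one_mem)
    rwa [map_one, mul_one] at this
  have hqcol : ∀ i, (Φ (q i)).1.col = χ m := fun i => by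
    rw [col_map_eq_of_col_eq hEu Φ (x := q i) (y := q j) rfl, hq j hj]
  have hrrow : ∀ l, (Φ (r l)).1.row = ψ j := fun l => by
    rw [row_map_eq_of_row_eq hEu Φ (x := r l) (y := r m) rfl, hr m hm]
  refine ⟨fun i => (Φ (q i)).1.row, fun l => (Φ (r l)).1.col,
    fun i => (Φ (q i)).1.val * (v m)⁻¹, fun l => (u j)⁻¹ * (Φ (r l)).1.val, ?_, ?_, ?_, ?_, ?_, ?_,
    ?_⟩
  · exact fun a b hab => row_eq_of_row_map_eq hEu Φ (x := q a) (y := q b) hab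
  · exact fun a b hab => col_eq_of_col_map_eq hEu Φ (x := r a) (y := r b) hab
  · exact fun i => H.mul_mem (hmem.mp (Φ (q i)).2) (H.inv_mem (hv m hm))
  · exact fun l => H.mul_mem (H.inv_mem (hu j hj)) (hmem.mp (Φ (r l)).2)
  · intro i hi
    simp [hq i hi]
  · intro l hl
    simp [hr l hl]
  · intro l hl i hi
    -- the entry `P l i` is read off the product `(j, 1, l) * (i, 1, m) = (j, P l i, m)`
    have h1 : r l * q i = ⟨⟨j, P l i, m⟩, hmem.mpr (entry_mem hH l i)⟩ := by
      apply Subtype.ext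
      change (⟨j, 1, l⟩ * ⟨i, 1, m⟩ : ReesMatrixSemigroup P) = _
      simp
    have h2 := congrArg (fun z => (Φ z).1.val) h1
    simp only [map_mul] at h2
    rw [hΦ' j hj m hm _ (hPA l hl i hi)] at h2
    have h3 : (Φ (r l)).1.val * P (Φ (r l)).1.col (Φ (q i)).1.row * (Φ (q i)).1.val =
      u j * Θ (P l i) * v m := h2
    have h4 : Θ (P l i) = (u j)⁻¹ * (u j * Θ (P l i) * v m) * (v m)⁻¹ := by group
    rw [h4, ← h3]
    simp only [mul_assoc]

end Step

end ReesMatrixSemigroup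

/-! ### Back and forth -/

namespace ReesMatrixSemigroup

/-- A total, surjective relation that is a partial injection on triples is the graph of a
permutation with factors. -/
lemma exists_perm_of_triples {G K : Type*} {R : Set (K × K × G)}
    (hl : ∀ a ∈ R, ∀ b ∈ R, a.1 = b.1 → a = b) (hr : ∀ a ∈ R, ∀ b ∈ R, a.2.1 = b.2.1 → a = b)
    (htot : ∀ i, ∃ a ∈ R, a.1 = i) (hsurj : ∀ i, ∃ a ∈ R, a.2.1 = i) :
    ∃ (ψ : K ≃ K) (u : K → G), (∀ i, (i, ψ i, u i) ∈ R) ∧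
      ∀ a ∈ R, a.2.1 = ψ a.1 ∧ a.2.2 = u a.1 := by
  choose f hf hf' using htot
  have hfR : ∀ a ∈ R, f a.1 = a := fun a ha => hl _ (hf _) _ ha (hf' _)
  have hbij : Function.Bijective fun i => (f i).2.1 := by
    constructor
    · intro i j hij
      have := hr _ (hf i) _ (hf j) hij
      rw [← hf' i, this, hf']
    · intro j
      obtain ⟨a, ha, rfl⟩ := hsurj j
      exact ⟨a.1, by simp only [hfR a ha]⟩
  refine ⟨Equiv.ofBijective _ hbij, fun i => (f i).2.2, fun i => ?_, fun a ha => ?_⟩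
  · have : (i, (f i).2.1, (f i).2.2) = f i := Prod.ext (hf' i).symm rfl
    change (i, (f i).2.1, (f i).2.2) ∈ R
    rw [this]
    exact hf i
  · simp [hfR a ha]

variable {G I Λ : Type*} [Group G] {P : Matrix Λ I G}

section BackAndForth

/-- A finite partial symmetry of the matrix `P` over the automorphism `Θ` of the group. A triple
`(i, j, u)` of `R` says that the column index `i` is sent to `j` with factor `u`, and a triple
`(l, m, v)` of `C` that the row index `l` is sent to `m` with factor `v`; both relations are
partial injections with factors in `H`, and they intertwine the entries of `P`. -/
structure IsPartialSymmetry (P : Matrix Λ I G) (H : Subgroup G) (Θ : G ≃* G)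
    (R : Set (I × I × G)) (C : Set (Λ × Λ × G)) : Prop where
  finite_fst : R.Finite
  finite_snd : C.Finite
  nonempty_fst : R.Nonempty
  nonempty_snd : C.Nonempty
  fst_left : ∀ a ∈ R, ∀ b ∈ R, a.1 = b.1 → a = b
  fst_right : ∀ a ∈ R, ∀ b ∈ R, a.2.1 = b.2.1 → a = b
  snd_left : ∀ a ∈ C, ∀ b ∈ C, a.1 = b.1 → a = b
  snd_right : ∀ a ∈ C, ∀ b ∈ C, a.2.1 = b.2.1 → a = b
  fst_mem : ∀ a ∈ R, a.2.2 ∈ H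
  snd_mem : ∀ c ∈ C, c.2.2 ∈ H
  entry_eq : ∀ a ∈ R, ∀ c ∈ C, Θ (P c.1 a.1) = c.2.2 * P c.2.1 a.2.1 * a.2.2

/-- The inverse of a triple `(i, j, u)` over the automorphism `Θ`. -/
def invTriple {K : Type*} (Θ : G ≃* G) (a : K × K × G) : K × K × G :=
  (a.2.1, a.1, (Θ.symm a.2.2)⁻¹)

lemma invTriple_invTriple {K : Type*} (Θ : G ≃* G) (a : K × K × G) :
    invTriple Θ (invTriple Θ.symm a) = a := by
  simp [invTriple]

/-- The graph over `J` of a map with factors. -/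
def tripleGraph {K : Type*} (J : Set K) (ψ : K → K) (u : K → G) : Set (K × K × G) :=
  (fun i => (i, ψ i, u i)) '' J

lemma exists_subset_tripleGraph {K : Type*} {R : Set (K × K × G)}
    (h : ∀ a ∈ R, ∀ b ∈ R, a.1 = b.1 → a = b) :
    ∃ (ψ : K → K) (u : K → G), R = tripleGraph (Prod.fst '' R) ψ u := by
  have h1 : ∀ i, ∃ p : K × G, ∀ a ∈ R, a.1 = i → a = (i, p) := fun i => by
    by_cases hi : ∃ a ∈ R, a.1 = i
    · obtain ⟨a, ha, rfl⟩ := hi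
      exact ⟨a.2, fun b hb hba => h b hb a ha hba⟩
    · exact ⟨(i, 1), fun a ha hai => absurd ⟨a, ha, hai⟩ hi⟩
  choose p hp using h1
  refine ⟨fun i => (p i).1, fun i => (p i).2, Set.Subset.antisymm ?_ ?_⟩
  · exact fun a ha => ⟨a.1, ⟨a, ha, rfl⟩, (hp a.1 a ha rfl).symm⟩
  · rintro _ ⟨_, ⟨a, ha, rfl⟩, rfl⟩
    have := hp a.1 a ha rfl
    change (a.1, p a.1) ∈ R
    rwa [← this]

variable {H : Subgroup G} {Θ : G ≃* G} {R : Set (I × I × G)} {C : Set (Λ × Λ × G)}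

lemma isPartialSymmetry_tripleGraph {J : Set I} {M : Set Λ} (hJ : J.Finite) (hM : M.Finite)
    (hJ' : J.Nonempty) (hM' : M.Nonempty) {ψ : I → I} {χ : Λ → Λ} {u : I → G} {v : Λ → G}
    (hψ : Set.InjOn ψ J) (hχ : Set.InjOn χ M) (hu : ∀ i ∈ J, u i ∈ H) (hv : ∀ l ∈ M, v l ∈ H)
    (heq : ∀ l ∈ M, ∀ i ∈ J, Θ (P l i) = v l * P (χ l) (ψ i) * u i) :
    IsPartialSymmetry P H Θ (tripleGraph J ψ u) (tripleGraph M χ v) where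
  finite_fst := hJ.image _
  finite_snd := hM.image _
  nonempty_fst := hJ'.image _
  nonempty_snd := hM'.image _
  fst_left := by
    rintro _ ⟨i, -, rfl⟩ _ ⟨j, -, rfl⟩ (rfl : i = j)
    rfl
  fst_right := by
    rintro _ ⟨i, hi, rfl⟩ _ ⟨j, hj, rfl⟩ h
    rw [hψ hi hj h]
  snd_left := by
    rintro _ ⟨i, -, rfl⟩ _ ⟨j, -, rfl⟩ (rfl : i = j)
    rfl
  snd_right := by
    rintro _ ⟨i, hi, rfl⟩ _ ⟨j, hj, rfl⟩ h
    rw [hχ hi hj h]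
  fst_mem := by
    rintro _ ⟨i, hi, rfl⟩
    exact hu i hi
  snd_mem := by
    rintro _ ⟨l, hl, rfl⟩
    exact hv l hl
  entry_eq := by
    rintro _ ⟨i, hi, rfl⟩ _ ⟨l, hl, rfl⟩
    exact heq l hl i hi

lemma IsPartialSymmetry.symm (hΘ : ∀ g, Θ g ∈ H ↔ g ∈ H) (h : IsPartialSymmetry P H Θ R C) :
    IsPartialSymmetry P H Θ.symm (invTriple Θ '' R) (invTriple Θ '' C) where
  finite_fst := h.finite_fst.image _
  finite_snd := h.finite_snd.image _
  nonempty_fst := h.nonempty_fst.image _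
  nonempty_snd := h.nonempty_snd.image _
  fst_left := by
    rintro _ ⟨a, ha, rfl⟩ _ ⟨b, hb, rfl⟩ hab
    rw [h.fst_right a ha b hb hab]
  fst_right := by
    rintro _ ⟨a, ha, rfl⟩ _ ⟨b, hb, rfl⟩ hab
    rw [h.fst_left a ha b hb hab]
  snd_left := by
    rintro _ ⟨a, ha, rfl⟩ _ ⟨b, hb, rfl⟩ hab
    rw [h.snd_right a ha b hb hab]
  snd_right := by
    rintro _ ⟨a, ha, rfl⟩ _ ⟨b, hb, rfl⟩ hab
    rw [h.snd_left a ha b hb hab]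
  fst_mem := by
    rintro _ ⟨a, ha, rfl⟩
    exact H.inv_mem ((hΘ _).mp (by simpa using h.fst_mem a ha))
  snd_mem := by
    rintro _ ⟨a, ha, rfl⟩
    exact H.inv_mem ((hΘ _).mp (by simpa using h.snd_mem a ha))
  entry_eq := by
    rintro _ ⟨a, ha, rfl⟩ _ ⟨c, hc, rfl⟩
    have h1 : P c.2.1 a.2.1 = c.2.2⁻¹ * Θ (P c.1 a.1) * a.2.2⁻¹ := by
      rw [h.entry_eq a ha c hc]; group
    simp only [invTriple, h1]
    simp

variable {i₀ : I} {l₀ : Λ}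

lemma IsPartialSymmetry.exists_forth (hcol : ∀ l : Λ, P l i₀ = 1) (hrow : ∀ i : I, P l₀ i = 1)
    (hH : (H : Set G) = matrixEntries P)
    (hE : IsHomogeneousCompletelySimple (idempotentGenerated (ReesMatrixSemigroup P)))
    (hΘ : ∀ g, Θ g ∈ H ↔ g ∈ H) (h : IsPartialSymmetry P H Θ R C) (i : I) (l : Λ) :
    ∃ R' C', IsPartialSymmetry P H Θ R' C' ∧ R ⊆ R' ∧ C ⊆ C' ∧ (∃ a ∈ R', a.1 = i) ∧
      ∃ c ∈ C', c.1 = l := by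
  obtain ⟨ψ, u, hR⟩ := exists_subset_tripleGraph h.fst_left
  obtain ⟨χ, v, hC⟩ := exists_subset_tripleGraph h.snd_left
  set J := Prod.fst '' R
  set M := Prod.fst '' C
  have hJ : ∀ i ∈ J, (i, ψ i, u i) ∈ R := fun i hi => hR ▸ ⟨i, hi, rfl⟩
  have hM : ∀ l ∈ M, (l, χ l, v l) ∈ C := fun l hl => hC ▸ ⟨l, hl, rfl⟩
  have hJfin : (insert i J).Finite := (h.finite_fst.image _).insert i
  have hMfin : (insert l M).Finite := (h.finite_snd.image _).insert l
  obtain ⟨ψ', χ', u', v', hψ', hχ', hu', hv', hJ', hM', heq⟩ := exists_extension_of_partial hcol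
    hrow hH hE Θ hΘ hJfin hMfin (Set.subset_insert i J) (Set.subset_insert l M)
    (h.nonempty_fst.image _) (h.nonempty_snd.image _) (ψ := ψ) (χ := χ) (u := u) (v := v)
    (fun a ha b hb hab => congrArg Prod.fst (h.fst_right _ (hJ a ha) _ (hJ b hb) hab))
    (fun a ha b hb hab => congrArg Prod.fst (h.snd_right _ (hM a ha) _ (hM b hb) hab))
    (fun a ha => h.fst_mem _ (hJ a ha)) (fun a ha => h.snd_mem _ (hM a ha))
    (fun c hc a ha => h.entry_eq _ (hJ a ha) _ (hM c hc))
  refine ⟨_, _, isPartialSymmetry_tripleGraph hJfin hMfin ⟨i, Set.mem_insert _ _⟩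
    ⟨l, Set.mem_insert _ _⟩ hψ'.injOn hχ'.injOn (fun a _ => hu' a) (fun a _ => hv' a) heq,
    ?_, ?_, ⟨_, ⟨i, Set.mem_insert _ _, rfl⟩, rfl⟩, ⟨_, ⟨l, Set.mem_insert _ _, rfl⟩, rfl⟩⟩
  · rw [hR]
    rintro _ ⟨a, ha, rfl⟩
    refine ⟨a, Set.mem_insert_of_mem _ ha, ?_⟩
    simp [hJ' a ha]
  · rw [hC]
    rintro _ ⟨a, ha, rfl⟩
    refine ⟨a, Set.mem_insert_of_mem _ ha, ?_⟩
    simp [hM' a ha]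

lemma IsPartialSymmetry.exists_back (hcol : ∀ l : Λ, P l i₀ = 1) (hrow : ∀ i : I, P l₀ i = 1)
    (hH : (H : Set G) = matrixEntries P)
    (hE : IsHomogeneousCompletelySimple (idempotentGenerated (ReesMatrixSemigroup P)))
    (hΘ : ∀ g, Θ g ∈ H ↔ g ∈ H) (h : IsPartialSymmetry P H Θ R C) (i : I) (l : Λ) :
    ∃ R' C', IsPartialSymmetry P H Θ R' C' ∧ R ⊆ R' ∧ C ⊆ C' ∧ (∃ a ∈ R', a.2.1 = i) ∧
      ∃ c ∈ C', c.2.1 = l := by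
  have hΘ' : ∀ g, Θ.symm g ∈ H ↔ g ∈ H := fun g => by rw [← hΘ, MulEquiv.apply_symm_apply]
  obtain ⟨R', C', h', hR, hC, ⟨a, ha, hai⟩, c, hc, hcl⟩ :=
    (h.symm hΘ).exists_forth hcol hrow hH hE hΘ' i l
  refine ⟨_, _, h'.symm hΘ', ?_, ?_, ⟨_, ⟨a, ha, rfl⟩, hai⟩, ⟨_, ⟨c, hc, rfl⟩, hcl⟩⟩
  · exact fun a ha => ⟨_, hR ⟨a, ha, rfl⟩, invTriple_invTriple Θ.symm a⟩
  · exact fun a ha => ⟨_, hC ⟨a, ha, rfl⟩, invTriple_invTriple Θ.symm a⟩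

/-- A finite partial symmetry extends to a symmetry of the whole matrix, over the same
automorphism of the group. -/
lemma IsPartialSymmetry.exists_total [Countable I] [Countable Λ] (hcol : ∀ l : Λ, P l i₀ = 1)
    (hrow : ∀ i : I, P l₀ i = 1) (hH : (H : Set G) = matrixEntries P)
    (hE : IsHomogeneousCompletelySimple (idempotentGenerated (ReesMatrixSemigroup P)))
    (hΘ : ∀ g, Θ g ∈ H ↔ g ∈ H) (h : IsPartialSymmetry P H Θ R C) :
    ∃ (ψ : I ≃ I) (χ : Λ ≃ Λ) (u : I → G) (v : Λ → G),
      (∀ a ∈ R, a.2.1 = ψ a.1 ∧ a.2.2 = u a.1) ∧ (∀ c ∈ C, c.2.1 = χ c.1 ∧ c.2.2 = v c.1) ∧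
      ∀ l i, Θ (P l i) = v l * P (χ l) (ψ i) * u i := by
  let Q := {s : Set (I × I × G) × Set (Λ × Λ × G) // IsPartialSymmetry P H Θ s.1 s.2}
  let forth (p : I × Λ) : Order.Cofinal Q :=
    { carrier := {s | (∃ a ∈ s.1.1, a.1 = p.1) ∧ ∃ c ∈ s.1.2, c.1 = p.2}
      isCofinal := fun s => by
        obtain ⟨R', C', h', hR, hC, hi, hl⟩ := s.2.exists_forth hcol hrow hH hE hΘ p.1 p.2
        exact ⟨⟨(R', C'), h'⟩, ⟨hi, hl⟩, hR, hC⟩ }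
  let back (p : I × Λ) : Order.Cofinal Q :=
    { carrier := {s | (∃ a ∈ s.1.1, a.2.1 = p.1) ∧ ∃ c ∈ s.1.2, c.2.1 = p.2}
      isCofinal := fun s => by
        obtain ⟨R', C', h', hR, hC, hi, hl⟩ := s.2.exists_back hcol hrow hH hE hΘ p.1 p.2
        exact ⟨⟨(R', C'), h'⟩, ⟨hi, hl⟩, hR, hC⟩ }
  have := Encodable.ofCountable (I × Λ ⊕ I × Λ)
  let F := Order.idealOfCofinals (⟨(R, C), h⟩ : Q) (Sum.elim forth back)
  have hF₀ : (⟨(R, C), h⟩ : Q) ∈ F := Order.mem_idealOfCofinals _ _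
  have hforth : ∀ p : I × Λ, ∃ s ∈ F, (∃ a ∈ s.1.1, a.1 = p.1) ∧ ∃ c ∈ s.1.2, c.1 = p.2 :=
    fun p => by
      obtain ⟨s, hs, hsF⟩ := Order.cofinal_meets_idealOfCofinals (⟨(R, C), h⟩ : Q)
        (Sum.elim forth back) (Sum.inl p)
      exact ⟨s, hsF, hs⟩
  have hback : ∀ p : I × Λ, ∃ s ∈ F, (∃ a ∈ s.1.1, a.2.1 = p.1) ∧ ∃ c ∈ s.1.2, c.2.1 = p.2 :=
    fun p => by
      obtain ⟨s, hs, hsF⟩ := Order.cofinal_meets_idealOfCofinals (⟨(R, C), h⟩ : Q)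
        (Sum.elim forth back) (Sum.inr p)
      exact ⟨s, hsF, hs⟩
  have hdir : ∀ s ∈ F, ∀ t ∈ F, ∃ w ∈ F, s ≤ w ∧ t ≤ w := fun s hs t ht =>
    F.directed s hs t ht
  let R' : Set (I × I × G) := {a | ∃ s ∈ F, a ∈ s.1.1}
  let C' : Set (Λ × Λ × G) := {c | ∃ s ∈ F, c ∈ s.1.2}
  obtain ⟨ψ, u, hψ, hψR⟩ := exists_perm_of_triples (R := R')
    (fun a ⟨s, hs, ha⟩ b ⟨t, ht, hb⟩ hab => by
      obtain ⟨w, -, hsw, htw⟩ := hdir s hs t ht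
      exact w.2.fst_left a (hsw.1 ha) b (htw.1 hb) hab)
    (fun a ⟨s, hs, ha⟩ b ⟨t, ht, hb⟩ hab => by
      obtain ⟨w, -, hsw, htw⟩ := hdir s hs t ht
      exact w.2.fst_right a (hsw.1 ha) b (htw.1 hb) hab)
    (fun i => by
      obtain ⟨s, hs, ⟨a, ha, hai⟩, -⟩ := hforth (i, l₀)
      exact ⟨a, ⟨s, hs, ha⟩, hai⟩)
    (fun i => by
      obtain ⟨s, hs, ⟨a, ha, hai⟩, -⟩ := hback (i, l₀)
      exact ⟨a, ⟨s, hs, ha⟩, hai⟩)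
  obtain ⟨χ, v, hχ, hχC⟩ := exists_perm_of_triples (R := C')
    (fun a ⟨s, hs, ha⟩ b ⟨t, ht, hb⟩ hab => by
      obtain ⟨w, -, hsw, htw⟩ := hdir s hs t ht
      exact w.2.snd_left a (hsw.2 ha) b (htw.2 hb) hab)
    (fun a ⟨s, hs, ha⟩ b ⟨t, ht, hb⟩ hab => by
      obtain ⟨w, -, hsw, htw⟩ := hdir s hs t ht
      exact w.2.snd_right a (hsw.2 ha) b (htw.2 hb) hab)
    (fun l => by
      obtain ⟨s, hs, -, c, hc, hcl⟩ := hforth (i₀, l)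
      exact ⟨c, ⟨s, hs, hc⟩, hcl⟩)
    (fun l => by
      obtain ⟨s, hs, -, c, hc, hcl⟩ := hback (i₀, l)
      exact ⟨c, ⟨s, hs, hc⟩, hcl⟩)
  refine ⟨ψ, χ, u, v, fun a ha => hψR a ⟨_, hF₀, ha⟩, fun c hc => hχC c ⟨_, hF₀, hc⟩, ?_⟩
  intro l i
  obtain ⟨s, hs, ha⟩ := hψ i
  obtain ⟨t, ht, hc⟩ := hχ l
  obtain ⟨w, -, hsw, htw⟩ := hdir s hs t ht
  exact w.2.entry_eq _ (hsw.1 ha) _ (htw.2 hc)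

end BackAndForth

/-! ### Coordinates of an isomorphism between finitely generated subsemigroups -/

section Coordinates

variable {T T₁ T₂ : Subsemigroup (ReesMatrixSemigroup P)}

variable (P) in
/-- The group coordinate of `x` when the matrix is normalised at `(i, l)`. It sends
`(i, p⁻¹ * g, l)` to `g`, where `p` is the matrix entry at `(l, i)`. -/
def baseVal (i : I) (l : Λ) (x : ReesMatrixSemigroup P) : G :=
  P l x.row * x.val * P x.col i * (P l i)⁻¹

lemma idem_mul_mul_idem (i : I) (l : Λ) (x : ReesMatrixSemigroup P) :
    idem P i l * x * idem P i l = ⟨i, (P l i)⁻¹ * baseVal P i l x, l⟩ := by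
  ext <;> simp [idem, baseVal, mul_assoc]

lemma baseVal_mem_maximalSubgroup (hT : IsUnaryClosed T) {i : I} {l : Λ} (h : idem P i l ∈ T)
    {x : ReesMatrixSemigroup P} (hx : x ∈ T) : baseVal P i l x ∈ maximalSubgroup hT i l h := by
  change (⟨i, (P l i)⁻¹ * baseVal P i l x, l⟩ : ReesMatrixSemigroup P) ∈ T
  rw [← idem_mul_mul_idem]
  exact T.mul_mem (T.mul_mem h hx) h

/-- With respect to a base point, the group coordinate is multiplicative up to the group
coordinate of an idempotent. -/
lemma baseVal_mul (i : I) (l : Λ) (x y : ReesMatrixSemigroup P) :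
    baseVal P i l (x * y) =
      baseVal P i l x * (baseVal P i l (idem P y.row x.col))⁻¹ * baseVal P i l y := by
  simp [baseVal, idem, mul_assoc]

lemma baseVal_relInv (i : I) (l : Λ) (x : ReesMatrixSemigroup P) :
    baseVal P i l x.relInv = baseVal P i l (idem P x.row x.col) * (baseVal P i l x)⁻¹ *
      baseVal P i l (idem P x.row x.col) := by
  simp [baseVal, idem, relInv, mul_assoc]

section FG

variable {X : Set (ReesMatrixSemigroup P)}

/-- The subsemigroup generated by `X` lies in the set of elements with row and column from `X`
and group coordinate in the subgroup generated by the coordinates of `X` and of the idempotents. -/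
lemma mem_of_mem_unaryClosure (i : I) (l : Λ) {x : ReesMatrixSemigroup P}
    (hx : x ∈ unaryClosure X) :
    x.row ∈ row '' X ∧ x.col ∈ col '' X ∧ baseVal P i l x ∈ Subgroup.closure
      (baseVal P i l '' X ∪ Set.image2 (fun j m => baseVal P i l (idem P j m))
        (row '' X) (col '' X)) := by
  set K := Subgroup.closure (baseVal P i l '' X ∪
    Set.image2 (fun j m => baseVal P i l (idem P j m)) (row '' X) (col '' X))
  have hK : ∀ j ∈ row '' X, ∀ m ∈ col '' X, baseVal P i l (idem P j m) ∈ K :=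
    fun j hj m hm => Subgroup.subset_closure (Or.inr ⟨j, hj, m, hm, rfl⟩)
  let W : Subsemigroup (ReesMatrixSemigroup P) :=
    { carrier := {x | x.row ∈ row '' X ∧ x.col ∈ col '' X ∧ baseVal P i l x ∈ K}
      mul_mem' := fun {x y} hx hy => ⟨hx.1, hy.2.1, by
        rw [baseVal_mul]
        exact K.mul_mem (K.mul_mem hx.2.2 (K.inv_mem (hK _ hy.1 _ hx.2.1))) hy.2.2⟩ }
  have hle : unaryClosure X ≤ W := by
    apply unaryClosure_le
    · exact fun x hx => ⟨⟨x, hx, rfl⟩, ⟨x, hx, rfl⟩,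
        Subgroup.subset_closure (Or.inl ⟨x, hx, rfl⟩)⟩
    · rw [isUnaryClosed_iff]
      refine fun x hx => ⟨hx.1, hx.2.1, ?_⟩
      rw [baseVal_relInv]
      exact K.mul_mem (K.mul_mem (hK _ hx.1 _ hx.2.1) (K.inv_mem hx.2.2)) (hK _ hx.1 _ hx.2.1)
  exact hle hx

/-- Maximal subgroups of finitely generated subsemigroups are finitely generated. -/
lemma maximalSubgroup_fg (hT : IsFGCompletelySimpleSub T) {i : I} {l : Λ} (h : idem P i l ∈ T) :
    (maximalSubgroup hT.isUnaryClosed i l h).FG := by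
  have hu := hT.isUnaryClosed
  obtain ⟨-, X, hX, rfl⟩ := hT
  refine (Subgroup.fg_iff _).mpr ⟨baseVal P i l '' X ∪ Set.image2
    (fun j m => baseVal P i l (idem P j m)) (row '' X) (col '' X), le_antisymm ?_ ?_,
    (hX.image _).union ((hX.image _).image2 _ (hX.image _))⟩
  · rw [Subgroup.closure_le]
    rintro _ (⟨x, hx, rfl⟩ | ⟨_, ⟨x, hx, rfl⟩, _, ⟨y, hy, rfl⟩, rfl⟩)
    · exact baseVal_mem_maximalSubgroup hu h (subset_unaryClosure X hx)
    · exact baseVal_mem_maximalSubgroup hu h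
        (idem_mem hu (subset_unaryClosure X hx) (subset_unaryClosure X hy))
  · intro g hg
    have := (mem_of_mem_unaryClosure i l hg).2.2
    simpa [baseVal] using this

lemma finite_rows (hT : IsFGCompletelySimpleSub T) :
    (row '' (T : Set (ReesMatrixSemigroup P))).Finite := by
  obtain ⟨hcs, X, hX, rfl⟩ := hT
  obtain ⟨x, -⟩ := nonempty_of_isCompletelySimple hcs
  refine (hX.image row).subset ?_
  rintro _ ⟨y, hy, rfl⟩
  exact (mem_of_mem_unaryClosure x.row x.col hy).1

lemma finite_cols (hT : IsFGCompletelySimpleSub T) :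
    (col '' (T : Set (ReesMatrixSemigroup P))).Finite := by
  obtain ⟨hcs, X, hX, rfl⟩ := hT
  obtain ⟨x, -⟩ := nonempty_of_isCompletelySimple hcs
  refine (hX.image col).subset ?_
  rintro _ ⟨y, hy, rfl⟩
  exact (mem_of_mem_unaryClosure x.row x.col hy).2.1

end FG

/-- The maps of rows and columns induced by an isomorphism. -/
lemma exists_index_maps (h₁ : IsUnaryClosed T₁) (h₂ : IsUnaryClosed T₂) (φ : T₁ ≃* T₂) :
    ∃ (ψ : I → I) (χ : Λ → Λ), (∀ x : T₁, (φ x).1.row = ψ x.1.row ∧ (φ x).1.col = χ x.1.col) ∧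
      Set.InjOn ψ (row '' (T₁ : Set (ReesMatrixSemigroup P))) ∧
      Set.InjOn χ (col '' (T₁ : Set (ReesMatrixSemigroup P))) := by
  have hψ : ∀ i, ∃ j, ∀ x : T₁, x.1.row = i → (φ x).1.row = j := fun i => by
    by_cases hi : ∃ x : T₁, x.1.row = i
    · obtain ⟨x, rfl⟩ := hi
      exact ⟨_, fun y hy => row_map_eq_of_row_eq h₁ φ hy⟩
    · exact ⟨i, fun x hx => absurd ⟨x, hx⟩ hi⟩
  have hχ : ∀ l, ∃ m, ∀ x : T₁, x.1.col = l → (φ x).1.col = m := fun l => by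
    by_cases hl : ∃ x : T₁, x.1.col = l
    · obtain ⟨x, rfl⟩ := hl
      exact ⟨_, fun y hy => col_map_eq_of_col_eq h₁ φ hy⟩
    · exact ⟨l, fun x hx => absurd ⟨x, hx⟩ hl⟩
  choose ψ hψ using hψ
  choose χ hχ using hχ
  refine ⟨ψ, χ, fun x => ⟨hψ _ x rfl, hχ _ x rfl⟩, ?_, ?_⟩
  · rintro _ ⟨x, hx, rfl⟩ _ ⟨y, hy, rfl⟩ hxy
    refine row_eq_of_row_map_eq h₂ φ (x := ⟨x, hx⟩) (y := ⟨y, hy⟩) ?_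
    rw [hψ _ ⟨x, hx⟩ rfl, hψ _ ⟨y, hy⟩ rfl, hxy]
  · rintro _ ⟨x, hx, rfl⟩ _ ⟨y, hy, rfl⟩ hxy
    refine col_eq_of_col_map_eq h₂ φ (x := ⟨x, hx⟩) (y := ⟨y, hy⟩) ?_
    rw [hχ _ ⟨x, hx⟩ rfl, hχ _ ⟨y, hy⟩ rfl, hxy]

/-- The isomorphism of maximal subgroups induced by `φ`, and the effect of `φ` on group
coordinates with respect to corresponding base points. -/
lemma exists_maximalSubgroup_equiv (h₁ : IsUnaryClosed T₁) (h₂ : IsUnaryClosed T₂) (φ : T₁ ≃* T₂)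
    {i j : I} {l m : Λ} (h : idem P i l ∈ T₁) (h' : idem P j m ∈ T₂)
    (hφ : φ ⟨idem P i l, h⟩ = ⟨idem P j m, h'⟩) :
    ∃ θ : maximalSubgroup h₁ i l h ≃* maximalSubgroup h₂ j m h', ∀ x : T₁,
      (θ ⟨baseVal P i l x, baseVal_mem_maximalSubgroup h₁ h x.2⟩ : G) = baseVal P j m (φ x) := by
  -- the inclusion of a maximal subgroup into the subsemigroup
  let f : maximalSubgroup h₁ i l h → T₁ := fun g => ⟨⟨i, (P l i)⁻¹ * g, l⟩, g.2⟩
  let f' : maximalSubgroup h₂ j m h' → T₂ := fun g => ⟨⟨j, (P m j)⁻¹ * g, m⟩, g.2⟩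
  have key : ∀ x : T₁, (φ (f ⟨baseVal P i l x, baseVal_mem_maximalSubgroup h₁ h x.2⟩)) =
      f' ⟨baseVal P j m (φ x), baseVal_mem_maximalSubgroup h₂ h' (φ x).2⟩ := by
    intro x
    have h3 : f ⟨baseVal P i l x, baseVal_mem_maximalSubgroup h₁ h x.2⟩ =
        ⟨idem P i l, h⟩ * x * ⟨idem P i l, h⟩ :=
      Subtype.ext (idem_mul_mul_idem i l x.1).symm
    rw [h3, map_mul, map_mul, hφ]
    exact Subtype.ext (idem_mul_mul_idem j m (φ x).1)
  have hbase : ∀ g : maximalSubgroup h₁ i l h, baseVal P i l (f g) = g := fun g => by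
    simp [f, baseVal]
  have hbase' : ∀ g : maximalSubgroup h₂ j m h', baseVal P j m (f' g) = g := fun g => by
    simp [f', baseVal]
  have hfmul : ∀ a b, f (a * b) = f a * f b := fun a b => by
    apply Subtype.ext
    change _ = (⟨i, (P l i)⁻¹ * a, l⟩ * ⟨i, (P l i)⁻¹ * b, l⟩ : ReesMatrixSemigroup P)
    simp [f, mul_assoc]
  have hφf : ∀ g, φ (f g) =
      f' ⟨baseVal P j m (φ (f g)), baseVal_mem_maximalSubgroup h₂ h' (φ (f g)).2⟩ := fun g => by
    rw [← key]
    congr 2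
    exact Subtype.ext (hbase g).symm
  let θ : maximalSubgroup h₁ i l h →* maximalSubgroup h₂ j m h' :=
    MonoidHom.mk' (fun g => ⟨baseVal P j m (φ (f g)),
      baseVal_mem_maximalSubgroup h₂ h' (φ (f g)).2⟩) fun a b => by
        apply Subtype.ext
        change baseVal P j m (φ (f (a * b))).1 =
          baseVal P j m (φ (f a)).1 * baseVal P j m (φ (f b)).1
        rw [hfmul, map_mul]
        change baseVal P j m ((φ (f a)).1 * (φ (f b)).1) = _
        have h4 : (φ (f a)).1.col = m := by rw [hφf a]
        have h5 : (φ (f b)).1.row = j := by rw [hφf b]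
        rw [baseVal_mul, h4, h5]
        simp [baseVal, idem]
  have hθ : ∀ g, φ (f g) = f' (θ g) := hφf
  have hbij : Function.Bijective θ := by
    constructor
    · intro a b hab
      have h3 := φ.injective ((hθ a).trans ((congrArg f' hab).trans (hθ b).symm))
      apply Subtype.ext
      rw [← hbase a, h3, hbase]
    · intro b
      refine ⟨⟨baseVal P i l (φ.symm (f' b)),
        baseVal_mem_maximalSubgroup h₁ h (φ.symm (f' b)).2⟩, ?_⟩
      apply Subtype.ext
      change baseVal P j m (φ (f _)).1 = b
      rw [key, hbase']
      change baseVal P j m (φ (φ.symm (f' b))).1 = b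
      rw [MulEquiv.apply_symm_apply, hbase']
  refine ⟨MulEquiv.ofBijective θ hbij, fun x => ?_⟩
  change baseVal P j m (φ (f _)).1 = _
  rw [key, hbase']

end Coordinates

/-! ### Homogeneity from the group and the idempotents -/

section Converse

variable {i₀ : I} {l₀ : Λ} {H : Subgroup G}

lemma isHomogeneous_of_characteristic [Countable I] [Countable Λ] (hcol : ∀ l : Λ, P l i₀ = 1)
    (hrow : ∀ i : I, P l₀ i = 1) (hG : IsHomogeneousGroup G)
    (hE : IsHomogeneousCompletelySimple (idempotentGenerated (ReesMatrixSemigroup P)))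
    (hH : (H : Set G) = matrixEntries P) (hchar : H.Characteristic) :
    IsHomogeneousCompletelySimple (ReesMatrixSemigroup P) := by
  have : Nonempty I := ⟨i₀⟩
  have : Nonempty Λ := ⟨l₀⟩
  refine ⟨isCompletelySimple, fun T₁ T₂ h₁ h₂ φ => ?_⟩
  have hu₁ := h₁.isUnaryClosed
  have hu₂ := h₂.isUnaryClosed
  obtain ⟨x₀, hx₀⟩ := nonempty_of_isCompletelySimple h₁.1
  obtain ⟨ψ, χ, hψχ, hψ, hχ⟩ := exists_index_maps hu₁ hu₂ φ
  set i := x₀.row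
  set l := x₀.col
  have he : idem P i l ∈ T₁ := idem_mem hu₁ hx₀ hx₀
  -- idempotents are determined by their row and column
  have hidem : ∀ (a : I) (b : Λ) (h : idem P a b ∈ T₁),
      (φ ⟨idem P a b, h⟩ : ReesMatrixSemigroup P) = idem P (ψ a) (χ b) := by
    intro a b h
    have h3 : IsIdempotentElem (⟨idem P a b, h⟩ : T₁) :=
      Subtype.ext (isIdempotentElem_idem a b)
    have h4 : IsIdempotentElem (φ ⟨idem P a b, h⟩ : ReesMatrixSemigroup P) :=
      congrArg Subtype.val (h3.map φ)
    rw [isIdempotentElem_iff.mp h4, (hψχ _).1, (hψχ _).2]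
    rfl
  have he' : idem P (ψ i) (χ l) ∈ T₂ := hidem i l he ▸ (φ _).2
  obtain ⟨θ, hθ⟩ := exists_maximalSubgroup_equiv hu₁ hu₂ φ he he' (Subtype.ext (hidem i l he))
  obtain ⟨Θ, hΘ⟩ := hG _ _ (maximalSubgroup_fg h₁ he) (maximalSubgroup_fg h₂ he') θ
  have hΘb : ∀ x : T₁, Θ (baseVal P i l x) = baseVal P (ψ i) (χ l) (φ x) := fun x =>
    (hΘ ⟨_, baseVal_mem_maximalSubgroup hu₁ he x.2⟩).trans (hθ x)
  have hΘH : ∀ g, Θ g ∈ H ↔ g ∈ H := fun g => by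
    have := hchar.fixed Θ
    exact SetLike.ext_iff.mp this g
  have hmem := entry_mem hH
  -- the factors of `φ`: it maps `(a, g, b)` to `(ψ a, u a * Θ g * v b, χ b)`; they lie in `H`
  -- because `H` contains all entries and is characteristic
  let u : I → G := fun a => (P (χ l) (ψ a))⁻¹ * Θ (P l a)
  let v : Λ → G := fun b => Θ (P b i * (P l i)⁻¹) * P (χ l) (ψ i) * (P (χ b) (ψ i))⁻¹
  have hpart := isPartialSymmetry_tripleGraph (P := P) (H := H) (Θ := Θ) (finite_rows h₁)
    (finite_cols h₁) ⟨_, x₀, hx₀, rfl⟩ ⟨_, x₀, hx₀, rfl⟩ hψ hχ (u := u) (v := v)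
    (fun a _ => H.mul_mem (H.inv_mem (hmem _ _)) ((hΘH _).mpr (hmem _ _)))
    (fun b _ => H.mul_mem (H.mul_mem ((hΘH _).mpr (H.mul_mem (hmem _ _) (H.inv_mem (hmem _ _))))
      (hmem _ _)) (H.inv_mem (hmem _ _)))
    (by
      rintro _ ⟨y, hy, rfl⟩ _ ⟨x, hx, rfl⟩
      -- apply `Θ` to the coordinate of the idempotent in row `x.row` and column `y.col`
      have hxy := idem_mem hu₁ hx hy
      have h3 := hΘb ⟨_, hxy⟩
      rw [hidem] at h3
      simp only [baseVal, idem] at h3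
      have h4 : v y.col * P (χ y.col) (ψ x.row) * u x.row = Θ (P y.col i * (P l i)⁻¹) *
          (P (χ l) (ψ x.row) * (P (χ y.col) (ψ x.row))⁻¹ * P (χ y.col) (ψ i) *
            (P (χ l) (ψ i))⁻¹)⁻¹ * Θ (P l x.row) := by
        simp only [u, v]
        group
      rw [h4, ← h3]
      simp [mul_assoc])
  obtain ⟨ψ', χ', u', v', hR, hC, heq⟩ := hpart.exists_total hcol hrow hH hE hΘH
  refine ⟨autOf Θ ψ' χ' u' v' heq, fun x => ?_⟩
  have hr := hR _ ⟨x.1.row, ⟨x.1, x.2, rfl⟩, rfl⟩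
  have hc := hC _ ⟨x.1.col, ⟨x.1, x.2, rfl⟩, rfl⟩
  simp only at hr hc
  have h3 := hΘb x
  simp only [baseVal, (hψχ x).1, (hψχ x).2] at h3
  ext
  · exact hr.1.symm.trans (hψχ x).1.symm
  · change u' x.1.row * Θ x.1.val * v' x.1.col = _
    rw [← hr.2, ← hc.2]
    have h4 : u x.1.row * Θ x.1.val * v x.1.col = (P (χ l) (ψ x.1.row))⁻¹ *
        Θ (P l x.1.row * x.1.val * P x.1.col i * (P l i)⁻¹) * P (χ l) (ψ i) *
          (P (χ x.1.col) (ψ i))⁻¹ := by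
      simp [u, v, mul_assoc]
    rw [h4, h3]
    group
  · exact hc.1.symm.trans (hψχ x).2.symm

end Converse

end ReesMatrixSemigroup

theorem theorem5p1 {G I Λ : Type*} [Group G] [Countable G] [Countable I] [Countable Λ]
    (P : Matrix Λ I G) (hP : IsNormalised P) :
    IsHomogeneousCompletelySimple (ReesMatrixSemigroup P) ↔
      IsHomogeneousGroup G ∧
      IsHomogeneousCompletelySimple (idempotentGenerated (ReesMatrixSemigroup P)) ∧
      ∃ H : Subgroup G, (H : Set G) = matrixEntries P ∧ H.Characteristic := by
  obtain ⟨i₀, l₀, hcol, hrow⟩ := hP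
  have : Nonempty I := ⟨i₀⟩
  have : Nonempty Λ := ⟨l₀⟩
  constructor
  · exact fun hS => ⟨ReesMatrixSemigroup.isHomogeneousGroup l₀ hcol hS,
      ReesMatrixSemigroup.isHomogeneous_idempotentGenerated hS,
      ReesMatrixSemigroup.exists_characteristic_subgroup hcol hrow hS⟩
  · rintro ⟨hG, hE, H, hH, hchar⟩
    exact ReesMatrixSemigroup.isHomogeneous_of_characteristic hcol hrow hG hE hH hchar
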